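/- Let $\Phi$ be a Runge–Kutta method with $I$ stages and real coefficients $a_{ij}, b_i$, i.e. $\Phi_{h,g}(x)=x+h\sum_i b_i g(v_i)$ with $v_i=x+h\sum_j a_{ij}g(v_j)$, and suppose it has order (at least) $p\ge 1$: for every smooth vector field $g$ on a space $\mathbb R^D$ and every $x$, $\Phi_{h,g}(x)=\phi_{h,g}(x)+O(h^{p+1})$ as $h\to0^+$, where $\phi_{t,g}$ is the time-$t$ flow of $y'=g(y)$. Fix an integer $S\ge1$. All norms on $\mathbb R^D\subset\mathbb C^D$ are $l_\infty$-norms, and $\mathcal B(V,r)=\bigcup_{z\in V}\mathcal B(z,r)$ is the union of the open complex balls of radius $r$ centred in $V$. Let $r_1,r_2,m>0$. There are constants $T_0>0$ and $C_1>0$ depending only on $r_1/m$, $r_2/m$, $S$ and $\Phi$, and a constant $C_2>0$ that may depend on $m$ as well, such that the following holds for every $D$. Let $f,f_\theta:\mathbb R^D\to\mathbb R^D$ be smooth, let $x\in\mathbb R^D$ and $t\ge0$ be such that the solutions $\phi_{\tau,f}(x)$ and $\phi_{\tau,f_\theta}(x)$ exist for $0\le\tau\le t$, put $V_s=\{\phi_{\tau,f}(x)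 : 0\le\tau\le s\}$, and suppose that $f$ and $f_\theta$ extend to analytic vector fields on $\mathcal B(V_t,r_1+r_2)\subset\mathbb C^D$ that are bounded by $m$ there. For $0\le s\le t$ and $h>0$ put $$\mathcal L_s=\frac1{Sh}\,\sup_{z\in\mathcal B(V_s,r_1)}\bigl\|(\Phi_{h,f_\theta})^S(z)-\phi_{Sh,f}(z)\bigr\|,$$ the solutions and the stages being taken in $\mathcal B(V_s,r_1+r_2)$. Then, for all $h>0$ with $Sh<T_0$, the quantity $\mathcal L_t$ is well defined (the flow and, uniquely, the $S$ numerical steps exist from every point of $\mathcal B(V_t,r_1)$) and finite, and: (a) if $\phi_{\tau,f_\theta}(x)\in\mathcal B(V_t,r_1+r_2)$ for all $0\le\tau\le t$, then for all such $h$ $$\|\phi_{t,f}(x)-\phi_{t,f_\theta}(x)\|\le\frac{C_2e^{C_1t}-C_2}{C_1}\,\bigl(h^p+\mathcal L_t\bigr);$$ (b) without this assumption there is a constant $C_1'>0$, which may depend also on $f$, $f_\theta$, $x$ and $t$ but not on $h$ or $s$, such that for all such $h$ and all $0\le s\le t$ $$\|\phi_{s,f}(x)-\phi_{s,f_\theta}(x)\|\le\frac{C_2e^{C_1's}-C_2}{C_1'}\,\bigl(h^p+\mathcal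 L_s\bigr).$$ -/

import Mathlib

namespace NeuralODE

open Set Filter Topology Asymptotics

section General

variable {E : Type*} [NormedAddCommGroup E] [NormedSpace ℝ E]

/-- `u` solves `u' = g(u)`, `u(0) = z` on the time interval `[0, τ]`, with values in `U`. -/
def IsSolution (g : E → E) (U : Set E) (z : E) (τ : ℝ) (u : ℝ → E) : Prop :=
  u 0 = z ∧ ∀ s ∈ Icc (0 : ℝ) τ, u s ∈ U ∧ HasDerivWithinAt u (g (u s)) (Icc 0 τ) s

open Classical in
/-- The time-`τ` flow map `φ_{τ,g}` of the vector field `g` on the domain `U` (by convention the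
identity at points from which there is no solution in `U` up to time `τ`). -/
noncomputable def flow (g : E → E) (U : Set E) (τ : ℝ) (z : E) : E :=
  if H : ∃ u, IsSolution g U z τ u then H.choose τ else z

/-- The supremum norm `‖g‖_K = sup_{z ∈ K} ‖g z‖`. -/
noncomputable def supNormOn (K : Set E) (g : E → E) : ℝ :=
  sSup ((fun z => ‖g z‖) '' K)

end General

/-- The coefficients of a Runge-Kutta method with `I` stages. -/
structure RungeKutta (I : ℕ) where
  a : Fin I → Fin I → ℝ
  b : Fin I → ℝ

namespace RungeKutta

variable {I : ℕ} {E : Type*} [NormedAddCommGroup E] [NormedSpace ℝ E]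

/-- The stage equations `v_i = z + h ∑_j a_{ij} g(v_j)`. -/
def IsStages (M : RungeKutta I) (g : E → E) (h : ℝ) (z : E) (v : Fin I → E) : Prop :=
  ∀ i, v i = z + h • ∑ j, M.a i j • g (v j)

/-- The value `z + h ∑_i b_i g(v_i)` computed from the stages `v`. -/
noncomputable def output (M : RungeKutta I) (g : E → E) (h : ℝ) (z : E) (v : Fin I → E) : E :=
  z + h • ∑ i, M.b i • g (v i)

/-- `w` is the result of one step of size `h` from `z`, all stages being in the domain `U`. -/
def IsStep (M : RungeKutta I) (g : E → E) (U : Set E) (h : ℝ) (z w : E) : Prop :=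
  ∃ v : Fin I → E, (∀ i, v i ∈ U) ∧ M.IsStages g h z v ∧ w = M.output g h z v

open Classical in
/-- The numerical one-step map `Φ_{h,g}` of the vector field `g` on the domain `U` (by convention
the identity at points from which there is no step with stages in `U`). -/
noncomputable def step (M : RungeKutta I) (g : E → E) (U : Set E) (h : ℝ) (z : E) : E :=
  if H : ∃ w, M.IsStep g U h z w then H.choose else z

/-- The method has order (at least) `p`: for every smooth vector field `g` on `ℝ^D` and every
initial value `x`, the numerical solution after one step and the exact solution at time `h`
differ by `O(h^{p+1})`. The numerical solution of an implicit method is the one given by the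
stages `v(h)` that tend to `x` as `h → 0`. -/
def HasOrder (M : RungeKutta I) (p : ℕ) : Prop :=
  ∀ (D : ℕ) (g : (Fin D → ℝ) → (Fin D → ℝ)), ContDiff ℝ (⊤ : ℕ∞) g →
    ∀ (x : Fin D → ℝ) (ε : ℝ) (u : ℝ → (Fin D → ℝ)) (v : ℝ → Fin I → (Fin D → ℝ)),
      0 < ε → IsSolution g univ x ε u →
      Tendsto v (𝓝[>] 0) (𝓝 (fun _ => x)) →
      (∀ᶠ h in 𝓝[>] (0 : ℝ), M.IsStages g h x (v h)) →
      (fun h : ℝ => M.output g h x (v h) - u h) =O[𝓝[>] 0] (fun h : ℝ => h ^ (p + 1))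

end RungeKutta

/-- The inclusion `ℝ^D ⊂ ℂ^D`; both carry the `l_∞` norm. -/
def complexify {D : ℕ} (x : Fin D → ℝ) : Fin D → ℂ := fun i => (x i : ℂ)

/-- `F` is an analytic extension, bounded by `m`, of the real vector field `f` to the subset `U`
of `ℂ^D`. -/
structure IsBoundedAnalyticExtension {D : ℕ} (f : (Fin D → ℝ) → (Fin D → ℝ))
    (F : (Fin D → ℂ) → (Fin D → ℂ)) (U : Set (Fin D → ℂ)) (m : ℝ) : Prop where
  analytic : AnalyticOnNhd ℂ F U
  extends_real : ∀ x : Fin D → ℝ, complexify x ∈ U → F (complexify x) = complexify (f x)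
  bounded : ∀ z ∈ U, ‖F z‖ ≤ m

/-- The trajectory `V_t = {φ_{τ,f}(x) | 0 ≤ τ ≤ t}`, as a subset of `ℂ^D`. -/
noncomputable def trajectory {D : ℕ} (f : (Fin D → ℝ) → (Fin D → ℝ)) (x : Fin D → ℝ) (t : ℝ) :
    Set (Fin D → ℂ) :=
  (fun τ => complexify (flow f univ τ x)) '' Icc 0 t

/-- The complex neighbourhood `B(V_t, r)`: the union of the open complex balls of radius `r`
centred at the points of `V_t`. -/
noncomputable def tube {D : ℕ} (f : (Fin D → ℝ) → (Fin D → ℝ)) (x : Fin D → ℝ) (t r : ℝ) :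
    Set (Fin D → ℂ) :=
  ⋃ z ∈ trajectory f x t, Metric.ball z r

/-- The map `(Φ_{h,G})^S - φ_{Sh,F}` for vector fields `F`, `G` on the domain `U`. -/
noncomputable def defect {I D : ℕ} (M : RungeKutta I) (S : ℕ) (h : ℝ)
    (F G : (Fin D → ℂ) → (Fin D → ℂ)) (U : Set (Fin D → ℂ)) (z : Fin D → ℂ) : Fin D → ℂ :=
  (M.step G U h)^[S] z - flow F U (S * h) z

/-- The learning loss `‖(Φ_{h,G})^S - φ_{Sh,F}‖_K / (S h)` on the set `K`. -/
noncomputable def learningLoss {I D : ℕ} (M : RungeKutta I) (S : ℕ) (h : ℝ)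
    (F G : (Fin D → ℂ) → (Fin D → ℂ)) (U K : Set (Fin D → ℂ)) : ℝ :=
  supNormOn K (defect M S h F G U) / (S * h)

/-- The learning loss on `K` is a genuine finite number: from every point of `K` the exact solution
exists up to time `S h`, each of the `S` numerical steps exists and is unique, and the supremum
is finite. -/
structure LossWellDefined {I D : ℕ} (M : RungeKutta I) (S : ℕ) (h : ℝ)
    (F G : (Fin D → ℂ) → (Fin D → ℂ)) (U K : Set (Fin D → ℂ)) : Prop where
  exact_solution : ∀ z ∈ K, ∃ u, IsSolution F U z (S * h) u
  numerical_step : ∀ z ∈ K, ∀ k < S, ∃! w, M.IsStep G U h ((M.step G U h)^[k] z) w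
  finite : BddAbove ((fun z => ‖defect M S h F G U z‖) '' K)

end NeuralODE

open NeuralODE

/-!
A Runge-Kutta method that reproduces the flow of `f` when it is fed with `fθ` must be fed with a
field close to `f`. The proof makes this quantitative and then compares trajectories.

*Uniform order of the method.* The definition of the order gives `O(h ^ (p + 1))` for each smooth
field separately. For a field that is holomorphic and bounded by `m` on a ball of radius `R`, both
the flow (`exists_holomorphic_flow`) and the numerical step (`exists_holomorphic_step`) are
holomorphic functions of a complex step size on a disc whose radius depends only on `R / m` and the
method: they are locally uniform limits of successive approximations. On that disc the local error
is at most `R`, and it vanishes to order `p + 1` at `0` because the order of the method applies to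
the field multiplied by a bump function, regarded as a field on some `ℝ^n`. The Schwarz lemma then
bounds the local error by `R (h / T) ^ (p + 1)`, with `T` the radius of the disc
(`RungeKutta.HasOrder.norm_step_sub_flow_le`), and `S` steps accumulate a multiple of it.

*From flows to fields.* Hence the two flows at time `S h` differ by at most
`S h (Λ + O(h ^ p))` on `B(V, r₁)`, where `Λ` is the learning loss. By Cauchy estimates in the form of
the Schwarz lemma, the difference of the fields at a point is the difference of the flows divided
by `S h`, up to `O(h)` times the supremum of the difference of the fields over a slightly larger
ball (`mul_norm_sub_le_norm_flow_sub`). Iterating `p` times on balls of decreasing radius, from the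
trivial bound `2 m`, gives `‖F - Fθ‖ = O(h ^ p + Λ)` on `V`
(`RungeKutta.HasOrder.norm_vectorField_sub_le`).

*From fields to trajectories.* Grönwall's inequality needs `‖f - fθ‖` only along the exact trajectory
and a Lipschitz estimate for `fθ` only between simultaneous points of the two trajectories. In the
tube the latter follows with the constant `2 m / (r₁ + r₂)` from the Schwarz lemma for nearby
points and from the bound `m` for distant ones; without the tube, compactness supplies some constant.
-/

namespace NeuralODE

open Set Filter Topology Asymptotics Metric

/-! ### Holomorphic functions and successive approximation -/

/-- The contraction principle with a holomorphic parameter: if `Rel u u'` says that `u'` is the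
successive approximation following `u`, and passing to the next approximation halves the
distances, then the approximations converge locally uniformly on `B`. -/
theorem exists_tendstoLocallyUniformlyOn_of_contraction {E : Type*} [NormedAddCommGroup E]
    [CompleteSpace E] {B : Set ℂ}
    {P : (ℂ → E) → Prop} {Rel : (ℂ → E) → (ℂ → E) → Prop} {C : ℝ} (u₀ : ℂ → E) (h₀ : P u₀)
    (hnext : ∀ u, P u → ∃ u', P u' ∧ Rel u u')
    (hbd : ∀ u v, P u → P v → ∀ ζ ∈ B, ‖u ζ - v ζ‖ ≤ C)
    (hcontr : ∀ u v u' v' (ε : ℝ), P u → P v → Rel u u' → Rel v v' →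
      (∀ ζ ∈ B, ‖u ζ - v ζ‖ ≤ ε) → ∀ ζ ∈ B, ‖u' ζ - v' ζ‖ ≤ ε / 2) :
    ∃ (U : ℕ → ℂ → E) (u : ℂ → E), (∀ n, P (U n)) ∧ (∀ n, Rel (U n) (U (n + 1))) ∧
      TendstoLocallyUniformlyOn U u atTop B := by
  choose! T hTP hTR using hnext
  have hP : ∀ n, P (T^[n] u₀) := by
    intro n
    induction n with
    | zero => exact h₀
    | succ n ih => rw [Function.iterate_succ_apply']; exact hTP _ ih
  have hR : ∀ n, Rel (T^[n] u₀) (T^[n + 1] u₀) := by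
    intro n
    rw [Function.iterate_succ_apply']
    exact hTR _ (hP n)
  have hgeo : ∀ n, ∀ ζ ∈ B, ‖(T^[n] u₀) ζ - (T^[n + 1] u₀) ζ‖ ≤ C / 2 ^ n := by
    intro n
    induction n with
    | zero => intro ζ hζ; simpa using hbd _ _ (hP 0) (hP 1) ζ hζ
    | succ n ih =>
      intro ζ hζ
      have := hcontr _ _ _ _ _ (hP n) (hP (n + 1)) (hR n) (hR (n + 1)) ih ζ hζ
      rw [pow_succ, ← div_div]
      exact this
  have hlim : ∀ ζ, ∃ l, ζ ∈ B → Tendsto (fun n => (T^[n] u₀) ζ) atTop (𝓝 l) := by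
    intro ζ
    by_cases hζ : ζ ∈ B
    · have hc : CauchySeq (fun n => (T^[n] u₀) ζ) := by
        refine cauchySeq_of_le_geometric_two (C := 2 * C) fun n => ?_
        rw [dist_eq_norm]
        simpa using hgeo n ζ hζ
      obtain ⟨l, hl⟩ := cauchySeq_tendsto_of_complete hc
      exact ⟨l, fun _ => hl⟩
    · exact ⟨0, fun h => absurd h hζ⟩
  choose u hu using hlim
  refine ⟨fun n => T^[n] u₀, u, hP, hR, ?_⟩
  refine TendstoUniformlyOn.tendstoLocallyUniformlyOn ?_
  rw [Metric.tendstoUniformlyOn_iff]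
  intro ε hε
  have hz : Tendsto (fun n : ℕ => 2 * C / 2 ^ n) atTop (𝓝 0) := by
    have := (tendsto_pow_atTop_nhds_zero_of_lt_one (r := (1 / 2 : ℝ)) (by norm_num)
      (by norm_num)).const_mul (2 * C)
    simpa [div_eq_mul_inv] using this
  filter_upwards [hz.eventually (gt_mem_nhds hε)] with n hn ζ hζ
  rw [dist_comm]
  refine lt_of_le_of_lt ?_ hn
  refine dist_le_of_le_geometric_two_of_tendsto (C := 2 * C) (f := fun n => (T^[n] u₀) ζ)
    (fun k => ?_) (hu ζ hζ) n
  rw [dist_eq_norm]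
  simpa using hgeo k ζ hζ

section Holomorphic

variable {E F : Type*} [NormedAddCommGroup E] [NormedSpace ℂ E]
  [NormedAddCommGroup F] [NormedSpace ℂ F]

/-- The Lipschitz estimate used throughout. The second point is an arbitrary point where `G` is
bounded by `m`: nearby it is the Schwarz lemma, far away the trivial bound `2 m`. -/
theorem norm_sub_le_of_differentiableOn_ball {G : E → F} {y y' : E} {ρ m : ℝ} (hρ : 0 < ρ)
    (hd : DifferentiableOn ℂ G (ball y ρ)) (hb : ∀ w ∈ ball y ρ, ‖G w‖ ≤ m) (hy' : ‖G y'‖ ≤ m) :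
    ‖G y - G y'‖ ≤ 2 * m / ρ * ‖y - y'‖ := by
  have hy : ‖G y‖ ≤ m := hb y (mem_ball_self hρ)
  have hm : 0 ≤ m := (norm_nonneg _).trans hy
  by_cases hyy : y' ∈ ball y ρ
  · have hmaps : MapsTo G (ball y ρ) (closedBall (G y) (2 * m)) := by
      intro w hw
      rw [mem_closedBall, dist_eq_norm]
      linarith [norm_sub_le (G w) (G y), hb w hw]
    have := Complex.dist_le_div_mul_dist_of_mapsTo_ball hd hmaps hyy
    rwa [dist_eq_norm, dist_eq_norm, norm_sub_rev, norm_sub_rev y'] at this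
  · have h1 : ρ ≤ ‖y - y'‖ := by
      rw [mem_ball, not_lt, dist_comm, dist_eq_norm] at hyy
      exact hyy
    calc ‖G y - G y'‖ ≤ 2 * m := by linarith [norm_sub_le (G y) (G y')]
      _ = 2 * m / ρ * ρ := by field_simp
      _ ≤ _ := by gcongr

/-- A bounded holomorphic field is Lipschitz on the half ball, whose points keep the distance `R / 2`
from the boundary. -/
theorem norm_sub_le_of_mem_ball_half {G : E → F} {z w w' : E} {R m : ℝ} (hR : 0 < R)
    (hd : DifferentiableOn ℂ G (ball z R)) (hb : ∀ y ∈ ball z R, ‖G y‖ ≤ m)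
    (hw : w ∈ ball z (R / 2)) (hw' : w' ∈ ball z R) :
    ‖G w - G w'‖ ≤ 4 * m / R * ‖w - w'‖ := by
  have hsub : ball w (R / 2) ⊆ ball z R := ball_subset_ball' (by
    rw [mem_ball] at hw; linarith)
  have := norm_sub_le_of_differentiableOn_ball (by positivity : 0 < R / 2) (hd.mono hsub)
    (fun y hy => hb y (hsub hy)) (hb w' hw')
  convert this using 2
  field_simp
  ring

/-- The Cauchy problem `u' = G(u)`, `u(0) = z` has a solution in complex time, on a disc whose
radius depends only on the radius of the domain of `G` and on the bound for `G`. -/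
theorem exists_holomorphic_solution [CompleteSpace E] {G : E → E} {z : E} {R m : ℝ}
    (hR : 0 < R) (hm : 0 < m) (hd : DifferentiableOn ℂ G (ball z R))
    (hb : ∀ y ∈ ball z R, ‖G y‖ ≤ m) :
    ∃ u : ℂ → E, ∀ ζ ∈ ball (0 : ℂ) (R / (8 * m)),
      ‖u ζ - z‖ ≤ m * ‖ζ‖ ∧ HasDerivAt u (G (u ζ)) ζ := by
  set B := ball (0 : ℂ) (R / (8 * m)) with hB
  have hBlt : ∀ ζ ∈ B, m * ‖ζ‖ < R / 8 := by
    intro ζ hζ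
    rw [hB, mem_ball_zero_iff, lt_div_iff₀ (by positivity)] at hζ
    linarith
  have hin : ∀ {w : E} {ζ : ℂ}, ζ ∈ B → ‖w - z‖ ≤ m * ‖ζ‖ → w ∈ ball z (R / 2) := by
    intro w ζ hζ hw
    rw [mem_ball, dist_eq_norm]
    linarith [hBlt ζ hζ]
  have hlip : ∀ w ∈ ball z (R / 2), ∀ w' ∈ ball z (R / 2),
      ‖G w - G w'‖ ≤ 4 * m / R * ‖w - w'‖ := fun w hw w' hw' =>
    norm_sub_le_of_mem_ball_half hR hd hb hw (ball_subset_ball (by linarith) hw')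
  have h0B : (0 : ℂ) ∈ B := mem_ball_self (by positivity)
  have hmv : ∀ (f f' : ℂ → E) (K : ℝ), (∀ ζ ∈ B, HasDerivAt f (f' ζ) ζ) →
      (∀ ζ ∈ B, ‖f' ζ‖ ≤ K) → ∀ ζ ∈ B, ‖f ζ - f 0‖ ≤ K * ‖ζ‖ := by
    intro f f' K h1 h2 ζ hζ
    have := (convex_ball (0 : ℂ) (R / (8 * m))).norm_image_sub_le_of_norm_hasDerivWithin_le
      (fun x hx => (h1 x hx).hasDerivWithinAt) h2 h0B hζ
    simpa using this
  have hcomp : ∀ u : ℂ → E, DifferentiableOn ℂ u B → (∀ ζ ∈ B, ‖u ζ - z‖ ≤ m * ‖ζ‖) →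
      DifferentiableOn ℂ (fun ζ => G (u ζ)) B := by
    intro u h1 h2
    exact hd.comp h1 fun ζ hζ => ball_subset_ball (by linarith) (hin hζ (h2 ζ hζ))
  obtain ⟨U, u, hP, hRel, hlim⟩ := exists_tendstoLocallyUniformlyOn_of_contraction
    (B := B) (P := fun u => DifferentiableOn ℂ u B ∧ ∀ ζ ∈ B, ‖u ζ - z‖ ≤ m * ‖ζ‖)
    (Rel := fun u u' => u' 0 = z ∧ ∀ ζ ∈ B, HasDerivAt u' (G (u ζ)) ζ) (C := R) (fun _ => z)
    ⟨differentiableOn_const _, fun ζ _ => by simp; positivity⟩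
    (by
      rintro u ⟨h1, h2⟩
      obtain ⟨u', hu'0, hu'⟩ := ((hcomp u h1 h2).isExactOn_ball).with_val_at 0 z
      refine ⟨u', ⟨fun ζ hζ => (hu' ζ hζ).differentiableAt.differentiableWithinAt, fun ζ hζ => ?_⟩,
        hu'0, hu'⟩
      have := hmv u' _ m hu'
        (fun ξ hξ => hb _ (ball_subset_ball (by linarith) (hin hξ (h2 ξ hξ)))) ζ hζ
      rwa [hu'0] at this)
    (by
      rintro u v ⟨_, h2⟩ ⟨_, h2'⟩ ζ hζ
      have := norm_sub_le_norm_sub_add_norm_sub (u ζ) z (v ζ)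
      rw [norm_sub_rev z] at this
      linarith [h2 ζ hζ, h2' ζ hζ, hBlt ζ hζ])
    (by
      rintro u v u' v' ε ⟨_, h2⟩ ⟨_, h2'⟩ ⟨hu0, hu⟩ ⟨hv0, hv⟩ hε ζ hζ
      have hε0 : 0 ≤ ε := (norm_nonneg _).trans (hε ζ hζ)
      have := hmv (fun ξ => u' ξ - v' ξ) _ (4 * m / R * ε)
        (fun ξ hξ => (hu ξ hξ).sub (hv ξ hξ))
        (fun ξ hξ => (hlip _ (hin hξ (h2 ξ hξ)) _ (hin hξ (h2' ξ hξ))).trans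
          (by gcongr; exact hε ξ hξ)) ζ hζ
      simp only [hu0, hv0, sub_self, sub_zero] at this
      refine this.trans ?_
      have h8 := (hBlt ζ hζ).le
      calc 4 * m / R * ε * ‖ζ‖ = 4 * (m * ‖ζ‖) * ε / R := by ring
        _ ≤ 4 * (R / 8) * ε / R := by gcongr
        _ = ε / 2 := by field_simp; ring)
  have hBo : IsOpen B := isOpen_ball
  have hud : DifferentiableOn ℂ u B :=
    hlim.differentiableOn (Eventually.of_forall fun n => (hP n).1) hBo
  have hub : ∀ ζ ∈ B, ‖u ζ - z‖ ≤ m * ‖ζ‖ := by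
    intro ζ hζ
    refine le_of_tendsto ((hlim.tendsto_at hζ).sub_const z).norm
      (Eventually.of_forall fun n => (hP n).2 ζ hζ)
  refine ⟨u, fun ζ hζ => ⟨hub ζ hζ, ?_⟩⟩
  have hder := ((hlim.deriv (Eventually.of_forall fun n => (hP n).1) hBo).tendsto_at hζ).comp
    (tendsto_add_atTop_nat 1)
  have huz : u ζ ∈ ball z R := ball_subset_ball (by linarith) (hin hζ (hub ζ hζ))
  have hG : Tendsto (fun n => G (U n ζ)) atTop (𝓝 (G (u ζ))) :=
    ((hd.differentiableAt (isOpen_ball.mem_nhds huz)).continuousAt.tendsto).comp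
      (hlim.tendsto_at hζ)
  have : deriv u ζ = G (u ζ) := by
    refine tendsto_nhds_unique hder (hG.congr fun n => ?_)
    exact (((hRel n).2 ζ hζ).deriv).symm
  rw [← this]
  exact (hud.differentiableAt (hBo.mem_nhds hζ)).hasDerivAt

/-- A function holomorphic and bounded on a disc that is `O(h ^ (p + 1))` as `h → 0` along the
positive reals satisfies the corresponding Schwarz estimate on the whole disc. -/
theorem norm_le_of_isBigO_nhdsGT [CompleteSpace E] {e : ℂ → E} {T K : ℝ} {p : ℕ} (hT : 0 < T)
    (hd : DifferentiableOn ℂ e (ball 0 T)) (hb : ∀ ζ ∈ ball (0 : ℂ) T, ‖e ζ‖ ≤ K)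
    (hO : (fun h : ℝ => e h) =O[𝓝[>] 0] fun h : ℝ => h ^ (p + 1)) {ζ : ℂ}
    (hζ : ζ ∈ ball (0 : ℂ) T) : ‖e ζ‖ ≤ K * (‖ζ‖ / T) ^ (p + 1) := by
  have hanal : AnalyticAt ℂ e 0 :=
    hd.analyticAt (isOpen_ball.mem_nhds (mem_ball_self hT))
  have hcast : Tendsto (fun h : ℝ => (h : ℂ)) (𝓝[>] 0) (𝓝 0) := by
    have : Tendsto (fun h : ℝ => (h : ℂ)) (𝓝 0) (𝓝 ((0 : ℝ) : ℂ)) :=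
      Complex.continuous_ofReal.tendsto 0
    rw [Complex.ofReal_zero] at this
    exact this.mono_left nhdsWithin_le_nhds
  have hO' : e =O[𝓝 0] fun ζ : ℂ => ζ ^ (p + 1) := by
    by_cases htop : analyticOrderAt e 0 = ⊤
    · rw [analyticOrderAt_eq_top] at htop
      exact (isBigO_zero _ _).congr' (htop.mono fun _ h => h.symm) EventuallyEq.rfl
    · obtain ⟨g, hg, hg0, hge⟩ := (hanal.analyticOrderAt_ne_top).1 htop
      set n := analyticOrderNatAt e 0
      -- Write `e ζ = ζ ^ n • g ζ` with `g 0 ≠ 0`; if `n ≤ p`, the one-sided bound forces `g 0 = 0`.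
      have hn : p + 1 ≤ n := by
        by_contra! hlt
        apply hg0
        have h1 : Tendsto (fun h : ℝ => g h) (𝓝[>] 0) (𝓝 (g 0)) :=
          hg.continuousAt.tendsto.comp hcast
        refine tendsto_nhds_unique h1 ?_
        obtain ⟨C, hC⟩ := hO.bound
        have h3 : Tendsto (fun h : ℝ => C * |h| ^ (p + 1 - n)) (𝓝[>] 0) (𝓝 0) := by
          have h4 : Continuous fun h : ℝ => C * |h| ^ (p + 1 - n) := by fun_prop
          have := h4.tendsto 0
          rw [abs_zero, zero_pow (by omega), mul_zero] at this
          exact this.mono_left nhdsWithin_le_nhds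
        refine squeeze_zero_norm' ?_ h3
        filter_upwards [hC, hcast.eventually hge, self_mem_nhdsWithin] with h hh1 hh2 hpos
        have hpos' : 0 < |h| := abs_pos.2 (ne_of_gt hpos)
        rw [hh2, sub_zero, norm_smul, norm_pow, norm_pow, Complex.norm_real, Real.norm_eq_abs] at hh1
        have : |h| ^ (p + 1) = |h| ^ n * |h| ^ (p + 1 - n) := by
          rw [← pow_add]; congr 1; omega
        rw [this] at hh1
        have h5 : |h| ^ n * ‖g h‖ ≤ |h| ^ n * (C * |h| ^ (p + 1 - n)) := by linarith
        exact le_of_mul_le_mul_left h5 (by positivity)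
      have h1 : e =O[𝓝 0] fun ζ : ℂ => ζ ^ n := by
        have h2 : (fun ζ : ℂ => (ζ - 0) ^ n • g ζ) =O[𝓝 0] fun ζ : ℂ => ζ ^ n • (1 : ℂ) := by
          simp only [sub_zero]
          exact (isBigO_refl _ _).smul (hg.continuousAt.tendsto.isBigO_one ℂ)
        simpa using h2.congr' (hge.mono fun _ h => h.symm) EventuallyEq.rfl
      refine h1.trans ?_
      refine IsBigO.of_bound 1 ?_
      filter_upwards [ball_mem_nhds (0 : ℂ) one_pos] with ζ hζ
      rw [mem_ball_zero_iff] at hζ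
      rw [norm_pow, norm_pow, one_mul]
      exact pow_le_pow_of_le_one (norm_nonneg _) hζ.le hn
  have he0 : e 0 = 0 := by
    have := hO'.eq_zero_imp.self_of_nhds
    simpa using this
  have := Complex.dist_le_mul_div_pow_of_mapsTo_ball_of_isLittleO (n := p) (R₂ := K) hd
    (fun w hw => by simpa [he0] using hb w hw) (by
      simp only [he0, sub_zero]
      refine hO'.trans_isLittleO ?_
      rw [← isLittleO_norm_left]
      simp only [norm_pow]
      exact ((isLittleO_pow_pow (𝕜 := ℝ) (Nat.lt_succ_self p)).comp_tendsto tendsto_norm_zero)) hζ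
  simpa [he0] using this

end Holomorphic

/-! ### Solutions of differential equations -/

section Solutions

variable {E : Type*} [NormedAddCommGroup E] [NormedSpace ℝ E]

theorem IsSolution.mono {g : E → E} {U : Set E} {z : E} {τ τ' : ℝ} {u : ℝ → E}
    (hu : IsSolution g U z τ u) (h : τ' ≤ τ) : IsSolution g U z τ' u :=
  ⟨hu.1, fun s hs => ⟨(hu.2 s ⟨hs.1, hs.2.trans h⟩).1,
    (hu.2 s ⟨hs.1, hs.2.trans h⟩).2.mono (Icc_subset_Icc_right h)⟩⟩

/-- The solution restarted at time `a` from `u a`. -/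
theorem IsSolution.shift {g : E → E} {U : Set E} {z : E} {a τ : ℝ} {u : ℝ → E} (ha : 0 ≤ a)
    (hu : IsSolution g U z (a + τ) u) : IsSolution g U (u a) τ (fun s => u (a + s)) := by
  refine ⟨by simp, fun s hs => ?_⟩
  have hs' : a + s ∈ Icc 0 (a + τ) := ⟨by linarith [hs.1], by linarith [hs.2]⟩
  refine ⟨(hu.2 _ hs').1, ?_⟩
  have h1 : HasDerivWithinAt (fun s : ℝ => a + s) 1 (Icc 0 τ) s :=
    ((hasDerivAt_id s).const_add a).hasDerivWithinAt
  have := (hu.2 _ hs').2.scomp s h1 (fun r hr => ⟨by linarith [hr.1], by linarith [hr.2]⟩)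
  simpa [Function.comp_def] using this

theorem IsSolution.norm_sub_le {g : E → E} {U : Set E} {z : E} {τ m : ℝ} {u : ℝ → E}
    (hu : IsSolution g U z τ u) (hb : ∀ y ∈ U, ‖g y‖ ≤ m) {s : ℝ} (hs : s ∈ Icc 0 τ) :
    ‖u s - z‖ ≤ m * s := by
  have := norm_image_sub_le_of_norm_deriv_le_segment' (fun r hr => (hu.2 r hr).2)
    (fun r hr => hb _ (hu.2 r ⟨hr.1, hr.2.le⟩).1) s hs
  rwa [hu.1, sub_zero] at this

/-- Stability of an ordinary differential equation: the vector field `g₁` has to be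
Lipschitz only along the two solutions. -/
theorem IsSolution.norm_sub_le_gronwallBound {g₁ g₂ : E → E} {U₁ U₂ : Set E} {z₁ z₂ : E}
    {τ K ε : ℝ} {u₁ u₂ : ℝ → E} (h₁ : IsSolution g₁ U₁ z₁ τ u₁) (h₂ : IsSolution g₂ U₂ z₂ τ u₂)
    (hK : ∀ s ∈ Icc 0 τ, ‖g₁ (u₁ s) - g₁ (u₂ s)‖ ≤ K * ‖u₁ s - u₂ s‖)
    (hε : ∀ s ∈ Icc 0 τ, ‖g₁ (u₂ s) - g₂ (u₂ s)‖ ≤ ε) {s : ℝ} (hs : s ∈ Icc 0 τ) :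
    ‖u₁ s - u₂ s‖ ≤ gronwallBound ‖z₁ - z₂‖ K ε s := by
  have hd : ∀ r ∈ Icc 0 τ, HasDerivWithinAt (fun r => u₁ r - u₂ r) (g₁ (u₁ r) - g₂ (u₂ r))
      (Icc 0 τ) r := fun r hr => (h₁.2 r hr).2.sub (h₂.2 r hr).2
  have := norm_le_gronwallBound_of_norm_deriv_right_le (δ := ‖z₁ - z₂‖) (K := K) (ε := ε)
    (fun r hr => (hd r hr).continuousWithinAt)
    (fun r hr => (hd r ⟨hr.1, hr.2.le⟩).mono_of_mem_nhdsWithin (Icc_mem_nhdsGE_of_mem hr))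
    (by simp [h₁.1, h₂.1]) (fun r hr => ?_) s hs
  · simpa using this
  · have hr' : r ∈ Icc 0 τ := ⟨hr.1, hr.2.le⟩
    calc ‖g₁ (u₁ r) - g₂ (u₂ r)‖
        = ‖(g₁ (u₁ r) - g₁ (u₂ r)) + (g₁ (u₂ r) - g₂ (u₂ r))‖ := by rw [sub_add_sub_cancel]
      _ ≤ _ := (norm_add_le _ _).trans (add_le_add (hK r hr') (hε r hr'))

theorem flow_eq_of_forall_eq {g : E → E} {U : Set E} {z : E} {τ : ℝ} {u : ℝ → E}
    (hu : IsSolution g U z τ u) (huniq : ∀ u', IsSolution g U z τ u' → u' τ = u τ) :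
    flow g U τ z = u τ := by
  have H : ∃ u, IsSolution g U z τ u := ⟨u, hu⟩
  rw [flow, dif_pos H]
  exact huniq _ H.choose_spec

end Solutions

/-! ### Holomorphic flows and numerical steps -/

namespace RungeKutta

variable {I : ℕ} (M : RungeKutta I)

/-- A size of the coefficients of a Runge-Kutta method that bounds at once `1`, the row sums
`∑ⱼ |aᵢⱼ|` and `∑ᵢ |bᵢ|`. -/
noncomputable def size : ℝ := 1 + (∑ i, ∑ j, |M.a i j|) + ∑ i, |M.b i|

theorem one_le_size : 1 ≤ M.size := by
  have h1 : 0 ≤ ∑ i, ∑ j, |M.a i j| :=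
    Finset.sum_nonneg fun i _ => Finset.sum_nonneg fun j _ => abs_nonneg _
  have h2 : 0 ≤ ∑ i, |M.b i| := Finset.sum_nonneg fun i _ => abs_nonneg _
  rw [size]
  linarith

theorem size_pos : 0 < M.size := one_pos.trans_le M.one_le_size

variable {E : Type*} [NormedAddCommGroup E] [NormedSpace ℝ E]

theorem norm_sum_a_smul_le (i : Fin I) {w : Fin I → E} {K : ℝ} (hK : 0 ≤ K)
    (hw : ∀ j, ‖w j‖ ≤ K) : ‖∑ j, M.a i j • w j‖ ≤ M.size * K := by
  have h1 : ∑ j, |M.a i j| ≤ M.size := by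
    have h2 : 0 ≤ ∑ i, |M.b i| := Finset.sum_nonneg fun i _ => abs_nonneg _
    have h3 : ∑ j, |M.a i j| ≤ ∑ i, ∑ j, |M.a i j| :=
      Finset.single_le_sum (f := fun i => ∑ j, |M.a i j|)
        (fun i _ => Finset.sum_nonneg fun j _ => abs_nonneg _) (Finset.mem_univ i)
    rw [size]
    linarith
  calc ‖∑ j, M.a i j • w j‖ ≤ ∑ j, |M.a i j| * K := norm_sum_le_of_le _ fun j _ => by
        rw [norm_smul, Real.norm_eq_abs]; gcongr; exact hw j
    _ = (∑ j, |M.a i j|) * K := by rw [Finset.sum_mul]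
    _ ≤ _ := by gcongr

theorem norm_sum_b_smul_le {w : Fin I → E} {K : ℝ} (hK : 0 ≤ K)
    (hw : ∀ j, ‖w j‖ ≤ K) : ‖∑ j, M.b j • w j‖ ≤ M.size * K := by
  have h1 : ∑ j, |M.b j| ≤ M.size := by
    have h2 : 0 ≤ ∑ i, ∑ j, |M.a i j| :=
      Finset.sum_nonneg fun i _ => Finset.sum_nonneg fun j _ => abs_nonneg _
    rw [size]
    linarith
  calc ‖∑ j, M.b j • w j‖ ≤ ∑ j, |M.b j| * K := norm_sum_le_of_le _ fun j _ => by
        rw [norm_smul, Real.norm_eq_abs]; gcongr; exact hw j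
    _ = (∑ j, |M.b j|) * K := by rw [Finset.sum_mul]
    _ ≤ _ := by gcongr

end RungeKutta

section Holomorphic

variable {I : ℕ} (M : RungeKutta I) {E : Type*} [NormedAddCommGroup E] [NormedSpace ℝ E]
  [NormedSpace ℂ E] [IsScalarTower ℝ ℂ E]

/-- The stage equations with a complex step size have a solution that is holomorphic in the step
size, on a disc whose radius depends only on the method, the radius of the domain of `G` and the
bound for `G`. -/
theorem exists_holomorphic_stages [CompleteSpace E] {G : E → E} {z : E} {R m : ℝ}
    (hR : 0 < R) (hm : 0 < m) (hd : DifferentiableOn ℂ G (ball z R))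
    (hb : ∀ y ∈ ball z R, ‖G y‖ ≤ m) :
    ∃ v : ℂ → Fin I → E, DifferentiableOn ℂ v (ball (0 : ℂ) (R / (8 * m * M.size))) ∧
      ∀ ζ ∈ ball (0 : ℂ) (R / (8 * m * M.size)), ∀ i, ‖v ζ i - z‖ ≤ M.size * m * ‖ζ‖ ∧
        v ζ i = z + ζ • ∑ j, M.a i j • G (v ζ j) := by
  set B := ball (0 : ℂ) (R / (8 * m * M.size)) with hB
  have hκ := M.size_pos
  have hBlt : ∀ ζ ∈ B, M.size * m * ‖ζ‖ < R / 8 := by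
    intro ζ hζ
    rw [hB, mem_ball_zero_iff, lt_div_iff₀ (by positivity)] at hζ
    linarith
  have hin : ∀ {w : E} {ζ : ℂ}, ζ ∈ B → ‖w - z‖ ≤ M.size * m * ‖ζ‖ → w ∈ ball z (R / 2) := by
    intro w ζ hζ hw
    rw [mem_ball, dist_eq_norm]
    linarith [hBlt ζ hζ]
  have hsub : ball z (R / 2) ⊆ ball z R := ball_subset_ball (by linarith)
  obtain ⟨V, v, hP, hRel, hlim⟩ := exists_tendstoLocallyUniformlyOn_of_contraction
    (B := B) (P := fun v : ℂ → Fin I → E => DifferentiableOn ℂ v B ∧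
      ∀ ζ ∈ B, ∀ i, ‖v ζ i - z‖ ≤ M.size * m * ‖ζ‖)
    (Rel := fun v v' => v' = fun ζ i => z + ζ • ∑ j, M.a i j • G (v ζ j)) (C := R) (fun _ _ => z)
    ⟨differentiableOn_const _, fun ζ _ i => by simp; positivity⟩
    (by
      rintro v ⟨h1, h2⟩
      refine ⟨_, ⟨?_, fun ζ hζ i => ?_⟩, rfl⟩
      · rw [differentiableOn_pi] at h1 ⊢
        intro i
        refine (differentiableOn_const _).add (differentiableOn_id.smul
          (DifferentiableOn.fun_sum fun j _ => ?_))
        have := (hd.comp (h1 j) fun ζ hζ => hsub (hin hζ (h2 ζ hζ j))).const_smul ((M.a i j : ℝ) : ℂ)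
        refine this.congr fun ζ _ => ?_
        exact (algebraMap_smul ℂ (M.a i j) (G (v ζ j))).symm
      · rw [add_sub_cancel_left, norm_smul, mul_comm]
        gcongr
        exact M.norm_sum_a_smul_le i hm.le fun j => hb _ (hsub (hin hζ (h2 ζ hζ j))))
    (by
      rintro u v ⟨_, h2⟩ ⟨_, h2'⟩ ζ hζ
      refine (pi_norm_le_iff_of_nonneg hR.le).2 fun i => ?_
      have := norm_sub_le_norm_sub_add_norm_sub (u ζ i) z (v ζ i)
      rw [norm_sub_rev z] at this
      rw [Pi.sub_apply]
      linarith [h2 ζ hζ i, h2' ζ hζ i, hBlt ζ hζ])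
    (by
      rintro u v u' v' ε ⟨_, h2⟩ ⟨_, h2'⟩ rfl rfl hε ζ hζ
      have hε0 : 0 ≤ ε := (norm_nonneg _).trans (hε ζ hζ)
      refine (pi_norm_le_iff_of_nonneg (by positivity)).2 fun i => ?_
      have h3 : ‖∑ j, M.a i j • (G (u ζ j) - G (v ζ j))‖ ≤ M.size * (4 * m / R * ε) := by
        refine M.norm_sum_a_smul_le i (by positivity) fun j => ?_
        refine (norm_sub_le_of_mem_ball_half hR hd hb (hin hζ (h2 ζ hζ j))
          (hsub (hin hζ (h2' ζ hζ j)))).trans ?_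
        gcongr
        exact (norm_le_pi_norm (u ζ - v ζ) j).trans (hε ζ hζ)
      have h8 := (hBlt ζ hζ).le
      rw [Pi.sub_apply, add_sub_add_left_eq_sub, ← smul_sub, ← Finset.sum_sub_distrib]
      simp only [← smul_sub]
      rw [norm_smul]
      calc ‖ζ‖ * _ ≤ ‖ζ‖ * (M.size * (4 * m / R * ε)) := by gcongr
        _ = 4 * (M.size * m * ‖ζ‖) * ε / R := by ring
        _ ≤ 4 * (R / 8) * ε / R := by gcongr
        _ = ε / 2 := by field_simp; ring)
  have hvb : ∀ ζ ∈ B, ∀ i, ‖v ζ i - z‖ ≤ M.size * m * ‖ζ‖ := by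
    intro ζ hζ i
    exact le_of_tendsto (((tendsto_pi_nhds.1 (hlim.tendsto_at hζ)) i).sub_const z).norm
      (Eventually.of_forall fun n => (hP n).2 ζ hζ i)
  refine ⟨v, hlim.differentiableOn (Eventually.of_forall fun n => (hP n).1) isOpen_ball,
    fun ζ hζ i => ⟨hvb ζ hζ i, ?_⟩⟩
  have hcoord := fun i => (tendsto_pi_nhds.1 (hlim.tendsto_at hζ)) i
  refine tendsto_nhds_unique ((hcoord i).comp (tendsto_add_atTop_nat 1)) ?_
  have hG : ∀ j, Tendsto (fun n => G (V n ζ j)) atTop (𝓝 (G (v ζ j))) := fun j =>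
    ((hd.differentiableAt (isOpen_ball.mem_nhds
      (hsub (hin hζ (hvb ζ hζ j))))).continuousAt.tendsto).comp (hcoord j)
  have : Tendsto (fun n => z + ζ • ∑ j, M.a i j • G (V n ζ j)) atTop
      (𝓝 (z + ζ • ∑ j, M.a i j • G (v ζ j))) :=
    (((tendsto_finsetSum _ fun j _ => (hG j).const_smul _).const_smul ζ).const_add z)
  refine this.congr fun n => ?_
  simp only [Function.comp_apply, hRel n]

/-- The flow of a bounded holomorphic vector field, for short times, is the restriction to real
times of a function that is holomorphic in time. -/
theorem exists_holomorphic_flow [CompleteSpace E] {G : E → E} {U : Set E} {z : E} {R m : ℝ}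
    (hR : 0 < R) (hm : 0 < m) (hU : ball z R ⊆ U) (hd : DifferentiableOn ℂ G (ball z R))
    (hb : ∀ y ∈ U, ‖G y‖ ≤ m) :
    ∃ u : ℂ → E, DifferentiableOn ℂ u (ball 0 (R / (8 * m))) ∧
      (∀ ζ ∈ ball (0 : ℂ) (R / (8 * m)), ‖u ζ - z‖ ≤ m * ‖ζ‖) ∧
      ∀ τ, 0 ≤ τ → τ < R / (8 * m) →
        IsSolution G U z τ (fun s : ℝ => u s) ∧ flow G U τ z = u τ := by
  obtain ⟨u, hu⟩ := exists_holomorphic_solution hR hm hd (fun y hy => hb y (hU hy))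
  refine ⟨u, fun ζ hζ => (hu ζ hζ).2.differentiableAt.differentiableWithinAt,
    fun ζ hζ => (hu ζ hζ).1, fun τ hτ hτ' => ?_⟩
  have hlt : m * τ < R / 8 := by
    rw [lt_div_iff₀ (by positivity)] at hτ'
    linarith
  have hmem : ∀ s ∈ Icc 0 τ, (s : ℂ) ∈ ball (0 : ℂ) (R / (8 * m)) := by
    intro s hs
    rw [mem_ball_zero_iff, Complex.norm_real, Real.norm_eq_abs, abs_of_nonneg hs.1]
    exact hs.2.trans_lt hτ'
  have hin : ∀ s ∈ Icc 0 τ, ∀ w : E, ‖w - z‖ ≤ m * s → w ∈ ball z (R / 2) := by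
    intro s hs w hw
    rw [mem_ball, dist_eq_norm]
    have : m * s ≤ m * τ := by gcongr; exact hs.2
    linarith
  have hsub : ball z (R / 2) ⊆ ball z R := ball_subset_ball (by linarith)
  have hsol : IsSolution G U z τ (fun s : ℝ => u s) := by
    refine ⟨?_, fun s hs => ⟨hU (hsub (hin s hs _ ?_)), ?_⟩⟩
    · have := (hu 0 (mem_ball_self (by positivity))).1
      simpa [sub_eq_zero] using this
    · simpa [abs_of_nonneg hs.1] using (hu s (hmem s hs)).1
    · have h1 := (hu s (hmem s hs)).2.scomp s Complex.ofRealCLM.hasDerivAt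
      simp only [Complex.ofRealCLM_apply, Complex.ofReal_one, one_smul] at h1
      exact h1.hasDerivWithinAt
  refine ⟨hsol, flow_eq_of_forall_eq hsol fun u' hu' => ?_⟩
  have hτmem : τ ∈ Icc 0 τ := ⟨hτ, le_rfl⟩
  have := hu'.norm_sub_le_gronwallBound hsol (K := 4 * m / R) (ε := 0)
    (fun s hs => norm_sub_le_of_mem_ball_half hR hd (fun y hy => hb y (hU hy))
      (hin s hs _ (hu'.norm_sub_le hb hs)) (hsub (hin s hs _ (hsol.norm_sub_le hb hs))))
    (fun s _ => by simp) hτmem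
  rw [sub_self, norm_zero, gronwallBound_ε0_δ0] at this
  exact sub_eq_zero.1 (norm_le_zero_iff.1 this)

/-- For small step sizes one step of a Runge-Kutta method with all stages in `U` exists and is
unique, and it is the restriction to real step sizes of a holomorphic function of the step size.
The stages are unique because they lie near `z`, where the stage equations are contracting. -/
theorem exists_holomorphic_step [CompleteSpace E] {G : E → E} {U : Set E} {z : E} {R m : ℝ}
    (hR : 0 < R) (hm : 0 < m) (hU : ball z R ⊆ U) (hd : DifferentiableOn ℂ G (ball z R))
    (hb : ∀ y ∈ U, ‖G y‖ ≤ m) :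
    ∃ (v : ℂ → Fin I → E) (w : ℂ → E),
      DifferentiableOn ℂ w (ball 0 (R / (8 * m * M.size))) ∧
      (∀ ζ ∈ ball (0 : ℂ) (R / (8 * m * M.size)),
        ‖w ζ - z‖ ≤ M.size * m * ‖ζ‖ ∧ ∀ i, ‖v ζ i - z‖ ≤ M.size * m * ‖ζ‖) ∧
      ∀ h : ℝ, 0 < h → h < R / (8 * m * M.size) →
        M.IsStages G h z (v h) ∧ w h = M.output G h z (v h) ∧ M.step G U h z = w h ∧
        ∃! w, M.IsStep G U h z w := by
  have hκ := M.size_pos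
  obtain ⟨v, hvd, hv⟩ := exists_holomorphic_stages M hR hm hd (fun y hy => hb y (hU hy))
  have hlt : ∀ ζ ∈ ball (0 : ℂ) (R / (8 * m * M.size)), M.size * m * ‖ζ‖ < R / 8 := by
    intro ζ hζ
    rw [mem_ball_zero_iff, lt_div_iff₀ (by positivity)] at hζ
    linarith
  have hin : ∀ ζ ∈ ball (0 : ℂ) (R / (8 * m * M.size)), ∀ y : E,
      ‖y - z‖ ≤ M.size * m * ‖ζ‖ → y ∈ ball z (R / 2) := by
    intro ζ hζ y hy
    rw [mem_ball, dist_eq_norm]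
    linarith [hlt ζ hζ]
  have hsub : ball z (R / 2) ⊆ ball z R := ball_subset_ball (by linarith)
  refine ⟨v, fun ζ => z + ζ • ∑ i, M.b i • G (v ζ i), ?_, fun ζ hζ =>
    ⟨?_, fun i => (hv ζ hζ i).1⟩, fun h hh hhlt => ?_⟩
  · rw [differentiableOn_pi] at hvd
    refine (differentiableOn_const _).add (differentiableOn_id.smul
      (DifferentiableOn.fun_sum fun j _ => ?_))
    have := (hd.comp (hvd j) fun ζ hζ => hsub (hin ζ hζ _ (hv ζ hζ j).1)).const_smul
      ((M.b j : ℝ) : ℂ)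
    refine this.congr fun ζ _ => ?_
    exact (algebraMap_smul ℂ (M.b j) (G (v ζ j))).symm
  · rw [add_sub_cancel_left, norm_smul, mul_comm]
    gcongr
    exact M.norm_sum_b_smul_le hm.le fun j => hb _ (hU (hsub (hin ζ hζ _ (hv ζ hζ j).1)))
  · have hnorm : ‖(h : ℂ)‖ = h := by rw [Complex.norm_real, Real.norm_eq_abs, abs_of_pos hh]
    have hmem : (h : ℂ) ∈ ball (0 : ℂ) (R / (8 * m * M.size)) := by
      rwa [mem_ball_zero_iff, hnorm]
    have hst : M.IsStages G h z (v h) := by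
      intro i
      conv_lhs => rw [(hv h hmem i).2]
      congr 1
      exact algebraMap_smul ℂ h _
    have hout : z + (h : ℂ) • ∑ i, M.b i • G (v h i) = M.output G h z (v h) := by
      rw [RungeKutta.output]
      congr 1
      exact algebraMap_smul ℂ h _
    have hstep : M.IsStep G U h z (M.output G h z (v h)) :=
      ⟨v h, fun i => hU (hsub (hin _ hmem _ (hv h hmem i).1)), hst, rfl⟩
    have huniq : ∀ w, M.IsStep G U h z w → w = M.output G h z (v h) := by
      rintro _ ⟨v', hv'U, hv', rfl⟩
      have hv'b : ∀ i, v' i ∈ ball z (R / 2) := by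
        intro i
        refine hin h hmem _ ?_
        conv_lhs => rw [hv' i]
        rw [add_sub_cancel_left, norm_smul, mul_comm, hnorm, Real.norm_eq_abs, abs_of_pos hh]
        gcongr
        exact M.norm_sum_a_smul_le i hm.le fun j => hb _ (hv'U j)
      have hle : ‖v' - v h‖ ≤ ‖v' - v h‖ / 2 := by
        refine (pi_norm_le_iff_of_nonneg (by positivity)).2 fun i => ?_
        have h3 : ‖∑ j, M.a i j • (G (v' j) - G (v h j))‖ ≤
            M.size * (4 * m / R * ‖v' - v h‖) := by
          refine M.norm_sum_a_smul_le i (by positivity) fun j => ?_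
          refine (norm_sub_le_of_mem_ball_half hR hd (fun y hy => hb y (hU hy)) (hv'b j)
            (hsub (hin h hmem _ (hv h hmem j).1))).trans ?_
          gcongr
          exact norm_le_pi_norm (v' - v h) j
        have h8 := (hlt h hmem).le
        rw [hnorm] at h8
        rw [Pi.sub_apply, hv' i, hst i, add_sub_add_left_eq_sub, ← smul_sub,
          ← Finset.sum_sub_distrib]
        simp only [← smul_sub]
        rw [norm_smul, Real.norm_eq_abs, abs_of_pos hh]
        calc h * _ ≤ h * (M.size * (4 * m / R * ‖v' - v h‖)) := by gcongr
          _ = 4 * (M.size * m * h) * ‖v' - v h‖ / R := by ring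
          _ ≤ 4 * (R / 8) * ‖v' - v h‖ / R := by gcongr
          _ = ‖v' - v h‖ / 2 := by field_simp; ring
      have h0 : ‖v' - v h‖ ≤ 0 := by linarith
      rw [sub_eq_zero.1 (norm_le_zero_iff.1 h0)]
    refine ⟨hst, hout, ?_, ⟨_, hstep, huniq⟩⟩
    have H : ∃ w, M.IsStep G U h z w := ⟨_, hstep⟩
    rw [RungeKutta.step, dif_pos H]
    exact (huniq _ H.choose_spec).trans hout.symm

end Holomorphic

/-! ### Uniform error bounds for a method of given order -/

section Order

variable {I : ℕ} {M : RungeKutta I} {p : ℕ} {E : Type*} [NormedAddCommGroup E] [NormedSpace ℝ E]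

/-- The order of the method, defined by smooth fields on the whole of `ℝ^n`, applies to a field
that is smooth near the initial value only, on any finite-dimensional space: multiply it by a
bump function and choose coordinates. -/
theorem RungeKutta.HasOrder.isBigO_output_sub [FiniteDimensional ℝ E] (hM : M.HasOrder p)
    {G : E → E} {z : E} {ρ ε : ℝ} (hρ : 0 < ρ) (hε : 0 < ε)
    (hG : ContDiffOn ℝ (⊤ : ℕ∞) G (ball z ρ)) {u : ℝ → E}
    (hu : IsSolution G (ball z (ρ / 4)) z ε u) {v : ℝ → Fin I → E}
    (hv : Tendsto v (𝓝[>] 0) (𝓝 fun _ => z)) (hs : ∀ᶠ h in 𝓝[>] (0 : ℝ), M.IsStages G h z (v h)) :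
    (fun h : ℝ => M.output G h z (v h) - u h) =O[𝓝[>] 0] fun h : ℝ => h ^ (p + 1) := by
  -- `χ` is `1` on the ball containing the solution and, for small `h`, the stages.
  let χ : ContDiffBump z := ⟨ρ / 4, ρ / 2, by positivity, by linarith⟩
  have hχ : ∀ y ∈ ball z (ρ / 4), χ y • G y = G y := by
    intro y hy
    rw [χ.one_of_mem_closedBall (ball_subset_closedBall hy), one_smul]
  have hg₀ : ContDiff ℝ (⊤ : ℕ∞) fun y => χ y • G y := by
    rw [contDiff_iff_contDiffAt]
    intro y
    by_cases hy : y ∈ ball z ρ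
    · exact χ.contDiff.contDiffAt.smul (hG.contDiffAt (isOpen_ball.mem_nhds hy))
    · have hy' : y ∈ (closedBall z (ρ / 2))ᶜ := by
        rw [mem_compl_iff, mem_closedBall]
        rw [mem_ball] at hy
        intro h
        linarith
      refine (contDiffAt_const (c := (0 : E))).congr_of_eventuallyEq ?_
      filter_upwards [isClosed_closedBall.isOpen_compl.mem_nhds hy'] with w hw
      have hw' : χ w = 0 := χ.zero_of_le_dist (by
        rw [mem_compl_iff, mem_closedBall, not_le] at hw
        exact hw.le)
      rw [hw', zero_smul]
  obtain ⟨e⟩ : Nonempty (E ≃L[ℝ] (Fin (Module.finrank ℝ E) → ℝ)) :=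
    ⟨ContinuousLinearEquiv.ofFinrankEq (by simp)⟩
  have hg : ContDiff ℝ (⊤ : ℕ∞) fun y => e (χ (e.symm y) • G (e.symm y)) :=
    e.contDiff.comp (hg₀.comp e.symm.contDiff)
  have hge : ∀ y ∈ ball z (ρ / 4), e (χ (e.symm (e y)) • G (e.symm (e y))) = e (G y) := by
    intro y hy
    rw [e.symm_apply_apply, hχ y hy]
  have hvmem : ∀ᶠ h in 𝓝[>] (0 : ℝ), ∀ i, v h i ∈ ball z (ρ / 4) := by
    rw [tendsto_pi_nhds] at hv
    exact eventually_all.2 fun i => (hv i).eventually (ball_mem_nhds z (by positivity))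
  have key := hM _ _ hg (e z) ε (fun s => e (u s)) (fun h i => e (v h i)) hε
    ⟨congrArg e hu.1, fun s hs => ⟨mem_univ _, by
      beta_reduce
      rw [hge _ (hu.2 s hs).1]
      exact e.toContinuousLinearMap.hasFDerivAt.comp_hasDerivWithinAt s (hu.2 s hs).2⟩⟩
    (by
      rw [tendsto_pi_nhds] at hv ⊢
      exact fun i => (e.continuous.tendsto z).comp (hv i))
    (by
      filter_upwards [hvmem, hs] with h h1 h2 i
      refine (congrArg e (h2 i)).trans ?_
      simp only [map_add, map_smul, map_sum]
      congr 2
      exact Finset.sum_congr rfl fun j _ => by rw [← hge _ (h1 j), map_smul])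
  refine (e.isBigO_comp_rev _ _).trans (key.congr' ?_ EventuallyEq.rfl)
  filter_upwards [hvmem] with h h1
  simp only [RungeKutta.output, map_sub, map_add, map_smul, map_sum]
  congr 3
  exact Finset.sum_congr rfl fun j _ => by rw [← hge _ (h1 j), map_smul]

end Order

section Holomorphic

variable {I : ℕ} {M : RungeKutta I} {p : ℕ} {E : Type*} [NormedAddCommGroup E] [NormedSpace ℝ E]
  [NormedSpace ℂ E] [IsScalarTower ℝ ℂ E]

/-- The local error of a method of order `p`, with a constant depending only on the method, the
radius of the domain of `G` and the bound for `G`: the error is a holomorphic function of the step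
size on a disc of fixed radius, so that the Schwarz lemma makes its vanishing order quantitative. -/
theorem RungeKutta.HasOrder.norm_step_sub_flow_le [FiniteDimensional ℝ E] (hM : M.HasOrder p)
    {G : E → E} {U : Set E} {z : E} {R m h : ℝ} (hR : 0 < R) (hm : 0 < m) (hU : ball z R ⊆ U)
    (hG : AnalyticOnNhd ℂ G (ball z R)) (hb : ∀ y ∈ U, ‖G y‖ ≤ m) (hh : 0 < h)
    (hlt : h < R / (8 * m * M.size)) :
    ‖M.step G U h z - flow G U h z‖ ≤ R * (8 * m * M.size * h / R) ^ (p + 1) := by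
  have := FiniteDimensional.complete ℝ E
  have hκ := M.size_pos
  have hd := hG.differentiableOn
  set T := R / (8 * m * M.size) with hT
  have hTpos : 0 < T := by positivity
  have hTle : T ≤ R / (8 * m) := by
    rw [hT, ← div_div]
    exact div_le_self (by positivity) M.one_le_size
  obtain ⟨u, hud, hub, hu⟩ := exists_holomorphic_flow hR hm hU hd hb
  obtain ⟨v, w, hwd, hwb, hw⟩ := exists_holomorphic_step M hR hm hU hd hb
  have hsub : ball (0 : ℂ) T ⊆ ball 0 (R / (8 * m)) := ball_subset_ball hTle
  have hIoo : ∀ᶠ h : ℝ in 𝓝[>] 0, h ∈ Ioo 0 T := Ioo_mem_nhdsGT hTpos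
  have hnorm : ∀ h ∈ Ioo 0 T, ‖(h : ℂ)‖ = h := fun h hh => by
    rw [Complex.norm_real, Real.norm_eq_abs, abs_of_pos hh.1]
  have hmem : ∀ h ∈ Ioo 0 T, (h : ℂ) ∈ ball (0 : ℂ) T := fun h hh => by
    rw [mem_ball_zero_iff, hnorm h hh]
    exact hh.2
  have hO : (fun h : ℝ => M.output G h z (v h) - u h) =O[𝓝[>] 0] fun h : ℝ => h ^ (p + 1) := by
    refine hM.isBigO_output_sub (ε := T / 2) hR (by positivity)
      ((hG.contDiffOn isOpen_ball.uniqueDiffOn).restrict_scalars ℝ) ?_ ?_ ?_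
    · have h2 := (hu (T / 2) (by positivity) (by linarith)).1
      refine ⟨h2.1, fun s hs => ⟨?_, (h2.2 s hs).2⟩⟩
      have h3 := h2.norm_sub_le hb hs
      have h4 : m * s ≤ m * (R / (8 * m)) := by
        gcongr
        linarith [hs.2]
      have h5 : m * (R / (8 * m)) = R / 8 := by field_simp
      rw [mem_ball, dist_eq_norm]
      linarith
    · rw [tendsto_pi_nhds]
      intro i
      rw [tendsto_iff_norm_sub_tendsto_zero]
      have h2 : Tendsto (fun h : ℝ => M.size * m * h) (𝓝[>] 0) (𝓝 0) := by
        have h4 : Continuous fun h : ℝ => M.size * m * h := by fun_prop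
        have := h4.tendsto 0
        rw [mul_zero] at this
        exact this.mono_left nhdsWithin_le_nhds
      refine squeeze_zero' (Eventually.of_forall fun _ => norm_nonneg _) ?_ h2
      filter_upwards [hIoo] with h hh
      have := (hwb h (hmem h hh)).2 i
      rwa [hnorm h hh] at this
    · filter_upwards [hIoo] with h hh
      exact (hw h hh.1 hh.2).1
  have hh' : h ∈ Ioo 0 T := ⟨hh, hlt⟩
  have := norm_le_of_isBigO_nhdsGT (e := fun ζ => w ζ - u ζ) (K := R) (p := p) hTpos
    (hwd.sub (hud.mono hsub)) (fun ζ hζ => ?_) ?_ (hmem h hh')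
  · rw [hnorm h hh'] at this
    rw [(hw h hh hlt).2.2.1, (hu h hh.le (hlt.trans_le hTle)).2]
    convert this using 3
    rw [hT]
    field_simp
  · have h1 := (hwb ζ hζ).1
    have h2 := hub ζ (hsub hζ)
    rw [mem_ball_zero_iff, hT, lt_div_iff₀ (by positivity)] at hζ
    have h3 := norm_sub_le_norm_sub_add_norm_sub (w ζ) z (u ζ)
    rw [norm_sub_rev z] at h3
    have h4 : m * ‖ζ‖ ≤ M.size * (m * ‖ζ‖) :=
      le_mul_of_one_le_left (by positivity) M.one_le_size
    linarith
  · refine hO.congr' ?_ EventuallyEq.rfl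
    filter_upwards [hIoo] with h hh
    rw [(hw h hh.1 hh.2).2.1]

/-- The accumulated error of `S` steps. -/
theorem RungeKutta.HasOrder.iterate_step [FiniteDimensional ℝ E] (hM : M.HasOrder p)
    {G : E → E} {U : Set E} {z : E} {R m h : ℝ} {S : ℕ} (hS : 1 ≤ S) (hR : 0 < R) (hm : 0 < m)
    (hU : ball z R ⊆ U) (hG : AnalyticOnNhd ℂ G (ball z R)) (hb : ∀ y ∈ U, ‖G y‖ ≤ m)
    (hh : 0 < h) (hlt : S * h < R / (16 * m * M.size)) :
    (∀ k < S, ∃! w, M.IsStep G U h ((M.step G U h)^[k] z) w) ∧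
      ‖(M.step G U h)^[S] z - z‖ ≤ R / 16 ∧
      ‖(M.step G U h)^[S] z - flow G U (S * h) z‖ ≤
        2 ^ S * (R / 2 * (16 * m * M.size * h / R) ^ (p + 1)) := by
  have := FiniteDimensional.complete ℝ E
  have hκ := M.size_pos
  have hd := hG.differentiableOn
  set ε := R / 2 * (16 * m * M.size * h / R) ^ (p + 1) with hε
  have hS' : (1 : ℝ) ≤ S := by exact_mod_cast hS
  have hhS : h ≤ S * h := le_mul_of_one_le_left hh.le hS'
  have hSm : S * (M.size * m * h) < R / 16 := by
    rw [lt_div_iff₀ (by positivity)] at hlt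
    linarith
  have hκm : ∀ a, 0 ≤ a → m * a ≤ M.size * m * a := fun a ha => by
    rw [mul_assoc]
    exact le_mul_of_one_le_left (by positivity) M.one_le_size
  have hh2 : h < R / 2 / (8 * m * M.size) := by
    have : R / 2 / (8 * m * M.size) = R / (16 * m * M.size) := by field_simp; norm_num
    linarith
  have hbd : ∀ k ≤ S, (k : ℝ) * (M.size * m * h) ≤ S * (M.size * m * h) := fun k hk => by
    gcongr
  have hballs : ∀ y, ‖y - z‖ ≤ R / 16 → ball y (R / 2) ⊆ ball z R := fun y hy =>
    ball_subset_ball' (by rw [dist_eq_norm]; linarith)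
  have hstep : ∀ y, ‖y - z‖ ≤ R / 16 → (∃! w, M.IsStep G U h y w) ∧
      ‖M.step G U h y - y‖ ≤ M.size * m * h := by
    intro y hy
    obtain ⟨v, w, -, hwb, hw⟩ := exists_holomorphic_step M (by positivity : 0 < R / 2) hm
      ((hballs y hy).trans hU) (hd.mono (hballs y hy)) hb
    obtain ⟨-, -, h1, h2⟩ := hw h hh hh2
    have hnorm : ‖(h : ℂ)‖ = h := by rw [Complex.norm_real, Real.norm_eq_abs, abs_of_pos hh]
    have h3 := (hwb h (by rwa [mem_ball_zero_iff, hnorm])).1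
    rw [hnorm] at h3
    exact ⟨h2, by rwa [h1]⟩
  have hiter : ∀ k ≤ S, ‖(M.step G U h)^[k] z - z‖ ≤ k * (M.size * m * h) := by
    intro k
    induction k with
    | zero => intro _; simp
    | succ k ih =>
      intro hk
      have h1 := ih (by omega)
      have h2 := hbd k (by omega)
      have h3 := (hstep _ (h1.trans (h2.trans hSm.le))).2
      rw [Function.iterate_succ_apply']
      have h4 := norm_sub_le_norm_sub_add_norm_sub (M.step G U h ((M.step G U h)^[k] z))
        ((M.step G U h)^[k] z) z
      push_cast
      linarith
  have hnear : ∀ k ≤ S, ‖(M.step G U h)^[k] z - z‖ ≤ R / 16 := fun k hk => by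
    linarith [hiter k hk, hbd k hk]
  refine ⟨fun k hk => (hstep _ (hnear k hk.le)).1, hnear S le_rfl, ?_⟩
  have hSlt : S * h < R / (8 * m) := by
    rw [lt_div_iff₀ (by positivity)]
    linarith [hκm (S * h) (by positivity)]
  obtain ⟨u, -, -, hu⟩ := exists_holomorphic_flow hR hm hU hd hb
  obtain ⟨husol, huflow⟩ := hu (S * h) (by positivity) hSlt
  -- One step adds at most `ε`, and the flow over a time `h` at most doubles earlier errors.
  have herr : ∀ k ≤ S, ‖(M.step G U h)^[k] z - u ((k * h : ℝ) : ℂ)‖ ≤ (2 ^ k - 1) * ε := by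
    intro k
    induction k with
    | zero =>
      intro _
      have := husol.1
      simp only [Complex.ofReal_zero] at this
      simp [this]
    | succ k ih =>
      intro hk
      set y := (M.step G U h)^[k] z with hy
      have hyz : ‖y - z‖ ≤ R / 16 := hnear k (by omega)
      have h1 : ‖M.step G U h y - flow G U h y‖ ≤ ε := by
        have := hM.norm_step_sub_flow_le (by positivity : 0 < R / 2) hm ((hballs y hyz).trans hU)
          (hG.mono (hballs y hyz)) hb hh hh2
        convert this using 3
        field_simp
        norm_num
      obtain ⟨a, -, -, ha⟩ := exists_holomorphic_flow (by positivity : 0 < R / 2) hm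
        ((hballs y hyz).trans hU) (hd.mono (hballs y hyz)) hb
      have hh8 : h < R / 2 / (8 * m) := by
        rw [lt_div_iff₀ (by positivity)]
        linarith [hκm (S * h) (by positivity), mul_le_mul_of_nonneg_left hhS hm.le]
      obtain ⟨hasol, haflow⟩ := ha h hh.le hh8
      have hkh : (k : ℝ) * h + h ≤ S * h := by
        have : ((k + 1 : ℕ) : ℝ) ≤ S := by exact_mod_cast hk
        push_cast at this
        nlinarith
      have hbsol := (husol.mono hkh).shift (a := k * h) (by positivity)
      have hmh : m * h ≤ R / 16 := by
        linarith [hκm (S * h) (by positivity), mul_le_mul_of_nonneg_left hhS hm.le]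
      have hK : ∀ s ∈ Icc 0 h, ‖G (a s) - G (u ((k * h + s : ℝ) : ℂ))‖ ≤
          4 * m / R * ‖a s - u ((k * h + s : ℝ) : ℂ)‖ := by
        intro s hs
        have hms : m * s ≤ m * h := by gcongr; exact hs.2
        refine norm_sub_le_of_mem_ball_half hR hd (fun y hy => hb y (hU hy)) ?_ ?_
        · have h2 := hasol.norm_sub_le hb hs
          have h3 := norm_sub_le_norm_sub_add_norm_sub (a s) y z
          rw [mem_ball, dist_eq_norm]
          linarith
        · have hr : k * h + s ∈ Icc 0 (S * h) :=
            ⟨by have := hs.1; positivity, by linarith [hs.2]⟩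
          have h2 := husol.norm_sub_le hb hr
          have h3 : m * (k * h + s) ≤ m * (S * h) := by gcongr; exact hr.2
          rw [mem_ball, dist_eq_norm]
          linarith [hκm (S * h) (by positivity)]
      have h2 := hasol.norm_sub_le_gronwallBound hbsol (K := 4 * m / R) (ε := 0) hK
        (fun s _ => by simp) ⟨hh.le, le_rfl⟩
      rw [gronwallBound_ε0, ← haflow] at h2
      have hexp : Real.exp (4 * m / R * h) ≤ 2 := by
        have h5 : 4 * m / R * h ≤ 1 / 4 := by
          rw [div_mul_eq_mul_div, div_le_iff₀ hR]
          linarith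
        have h6 := Real.abs_exp_sub_one_le (x := 4 * m / R * h) (by
          rw [abs_of_nonneg (by positivity)]; linarith)
        rw [abs_of_nonneg (by positivity : 0 ≤ 4 * m / R * h)] at h6
        linarith [le_abs_self (Real.exp (4 * m / R * h) - 1)]
      have h3 := ih (by omega)
      have h4 : ‖flow G U h y - u ((k * h + h : ℝ) : ℂ)‖ ≤ (2 ^ k - 1) * ε * 2 :=
        h2.trans (mul_le_mul h3 hexp (Real.exp_pos _).le ((norm_nonneg _).trans h3))
      have h5 := norm_sub_le_norm_sub_add_norm_sub (M.step G U h y) (flow G U h y)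
        (u ((k * h + h : ℝ) : ℂ))
      rw [Function.iterate_succ_apply', ← hy]
      have hcast : ((k + 1 : ℕ) : ℝ) * h = k * h + h := by push_cast; ring
      rw [hcast, pow_succ]
      linarith
  rw [huflow]
  refine (herr S le_rfl).trans ?_
  have hε0 : 0 ≤ ε := by positivity
  nlinarith

/-! ### Comparison of vector fields through their flows -/

/-- The difference of two vector fields at `z` is recovered from the difference of their flows at
time `τ` up to an error `O(τ δ)`, where `δ` bounds the difference of the fields near `z`. -/
theorem mul_norm_sub_le_norm_flow_sub {F G : E → E} {U : Set E} [CompleteSpace E]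
    {z : E} {R m τ δ : ℝ} (hR : 0 < R)
    (hm : 0 < m) (hU : ball z R ⊆ U) (hFd : DifferentiableOn ℂ F (ball z R))
    (hFb : ∀ y ∈ U, ‖F y‖ ≤ m) (hGd : DifferentiableOn ℂ G (ball z R))
    (hGb : ∀ y ∈ U, ‖G y‖ ≤ m) (hδ : ∀ y ∈ ball z R, ‖F y - G y‖ ≤ δ) (hτ : 0 ≤ τ)
    (hτR : τ < R / (16 * m)) :
    τ * ‖F z - G z‖ ≤ ‖flow F U τ z - flow G U τ z‖ + 10 * m * δ * τ ^ 2 / R := by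
  have hτ8 : τ < R / (8 * m) := hτR.trans_le (by gcongr; norm_num)
  obtain ⟨u, -, -, hu⟩ := exists_holomorphic_flow hR hm hU hFd hFb
  obtain ⟨w, -, -, hw⟩ := exists_holomorphic_flow hR hm hU hGd hGb
  obtain ⟨hus, huf⟩ := hu τ hτ hτ8
  obtain ⟨hws, hwf⟩ := hw τ hτ hτ8
  have hδ0 : 0 ≤ δ := (norm_nonneg _).trans (hδ z (mem_ball_self hR))
  have hmτ : m * τ < R / 16 := by
    rw [lt_div_iff₀ (by positivity)] at hτR
    linarith
  have hms : ∀ s ∈ Icc 0 τ, m * s ≤ m * τ := fun s hs => by gcongr; exact hs.2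
  have huin : ∀ s ∈ Icc 0 τ, u s ∈ ball z (R / 2) := fun s hs => by
    rw [mem_ball, dist_eq_norm]
    linarith [hus.norm_sub_le hFb hs, hms s hs]
  have hwin : ∀ s ∈ Icc 0 τ, w s ∈ ball z R := fun s hs => by
    rw [mem_ball, dist_eq_norm]
    linarith [hws.norm_sub_le hGb hs, hms s hs]
  have hK : ∀ s ∈ Icc 0 τ, ‖F (u s) - F (w s)‖ ≤ 4 * m / R * ‖u s - w s‖ := fun s hs =>
    norm_sub_le_of_mem_ball_half hR hFd (fun y hy => hFb y (hU hy)) (huin s hs) (hwin s hs)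
  have he : ∀ s ∈ Icc 0 τ, ‖u s - w s‖ ≤ 2 * δ * s := by
    intro s hs
    have h1 := hus.norm_sub_le_gronwallBound hws hK (fun s hs => hδ _ (hwin s hs)) hs
    have hK0 : 4 * m / R ≠ 0 := by positivity
    rw [sub_self, norm_zero, gronwallBound_of_K_ne_0 hK0] at h1
    beta_reduce at h1
    rw [zero_mul, zero_add] at h1
    have hs0 := hs.1
    have h5 : 4 * m / R * s ≤ 1 := by
      rw [div_mul_eq_mul_div, div_le_iff₀ hR]
      linarith [hms s hs]
    have h6 := Real.abs_exp_sub_one_le (x := 4 * m / R * s) (by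
      rw [abs_of_nonneg (by positivity)]; linarith)
    rw [abs_of_nonneg (by positivity : 0 ≤ 4 * m / R * s)] at h6
    calc ‖u s - w s‖ ≤ δ / (4 * m / R) * (Real.exp (4 * m / R * s) - 1) := h1
      _ ≤ δ / (4 * m / R) * (2 * (4 * m / R * s)) := by
        gcongr
        exact (le_abs_self _).trans h6
      _ = 2 * δ * s := by field_simp
  -- The quantity `u s - w s - s • (F z - G z)` vanishes at `s = 0` and has derivative `O(δ τ)`.
  have hd : ∀ s ∈ Icc 0 τ, HasDerivWithinAt (fun s : ℝ => u s - w s - s • (F z - G z))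
      (F (u s) - G (w s) - (F z - G z)) (Icc 0 τ) s := by
    intro s hs
    have h1 := ((hasDerivAt_id s).smul_const (F z - G z)).hasDerivWithinAt (s := Icc 0 τ)
    rw [one_smul] at h1
    exact ((hus.2 s hs).2.sub (hws.2 s hs).2).sub h1
  have hdb : ∀ s ∈ Ico 0 τ, ‖F (u s) - G (w s) - (F z - G z)‖ ≤ 10 * m * δ * τ / R := by
    intro s hs
    have hs' : s ∈ Icc 0 τ := ⟨hs.1, hs.2.le⟩
    have hs0 := hs.1
    have h1 : ‖(F z - G z) - (F (w s) - G (w s))‖ ≤ 2 * δ / R * ‖z - w s‖ :=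
      norm_sub_le_of_differentiableOn_ball (G := fun y => F y - G y) hR (hFd.sub hGd) hδ
        (hδ _ (hwin s hs'))
    have h2 : ‖z - w s‖ ≤ m * s := by
      rw [norm_sub_rev]
      exact hws.norm_sub_le hGb hs'
    have h3 : F (u s) - G (w s) - (F z - G z) =
      (F (u s) - F (w s)) - ((F z - G z) - (F (w s) - G (w s))) := by abel
    calc ‖F (u s) - G (w s) - (F z - G z)‖
        ≤ ‖F (u s) - F (w s)‖ + ‖(F z - G z) - (F (w s) - G (w s))‖ := by
          rw [h3]; exact norm_sub_le _ _
      _ ≤ 4 * m / R * (2 * δ * s) + 2 * δ / R * (m * s) := by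
          refine add_le_add ((hK s hs').trans ?_) (h1.trans ?_)
          · gcongr; exact he s hs'
          · gcongr
      _ = 10 * m * δ * s / R := by ring
      _ ≤ _ := by gcongr; exact hs.2.le
  have h1 := norm_image_sub_le_of_norm_deriv_le_segment' hd hdb τ ⟨hτ, le_rfl⟩
  have h0 : u ((0 : ℝ) : ℂ) - w ((0 : ℝ) : ℂ) - (0 : ℝ) • (F z - G z) = 0 := by
    rw [show u ((0 : ℝ) : ℂ) = z from hus.1, show w ((0 : ℝ) : ℂ) = z from hws.1]
    simp
  rw [h0, sub_zero, sub_zero] at h1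
  rw [huf, hwf]
  have h2 := norm_sub_norm_le (τ • (F z - G z)) (u τ - w τ)
  rw [norm_smul, Real.norm_eq_abs, abs_of_nonneg hτ, norm_sub_rev (τ • (F z - G z))] at h2
  have h3 : 10 * m * δ * τ / R * τ = 10 * m * δ * τ ^ 2 / R := by ring
  linarith

end Holomorphic

section Complex

variable {I : ℕ} {M : RungeKutta I} {p : ℕ}

section

variable {E : Type*} [NormedAddCommGroup E] [NormedSpace ℝ E]
  [NormedSpace ℂ E] [IsScalarTower ℝ ℂ E]

/-- Two vector fields are close on `V` if `S` numerical steps for one are close to the flow of the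
other on a neighbourhood of `V`. Comparing flows bounds the difference of the fields on a
smaller neighbourhood by `Λ + O(h ^ p)` plus `O(h)` times its bound on the larger one, so that `p`
repetitions, each giving up the fraction `1 / (p + 1)` of the radius `r₁`, suffice. -/
theorem RungeKutta.HasOrder.norm_vectorField_sub_le [FiniteDimensional ℝ E] (hM : M.HasOrder p)
    {F G : E → E} {V : Set E} {r₁ r₂ R m h Λ : ℝ} {S : ℕ} (hS : 1 ≤ S) (hR : 0 < R) (hm : 0 < m)
    (hR₁ : R ≤ r₁ / (p + 1)) (hR₂ : R ≤ r₂)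
    (hF : AnalyticOnNhd ℂ F (thickening (r₁ + r₂) V))
    (hFb : ∀ y ∈ thickening (r₁ + r₂) V, ‖F y‖ ≤ m)
    (hG : AnalyticOnNhd ℂ G (thickening (r₁ + r₂) V))
    (hGb : ∀ y ∈ thickening (r₁ + r₂) V, ‖G y‖ ≤ m)
    (hh : 0 < h) (hlt : S * h < R / (16 * m * M.size))
    (hΛ : ∀ z ∈ thickening r₁ V, ‖(M.step G (thickening (r₁ + r₂) V) h)^[S] z -
      flow F (thickening (r₁ + r₂) V) (S * h) z‖ ≤ S * h * Λ) {z : E} (hz : z ∈ V) :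
    ‖F z - G z‖ ≤ p * (Λ + 2 ^ S * (8 * m * M.size) * (16 * m * M.size * h / R) ^ p) +
      2 * m * (10 * m * (S * h) / R) ^ p := by
  have := FiniteDimensional.complete ℝ E
  have hκ := M.size_pos
  have hS' : (1 : ℝ) ≤ S := by exact_mod_cast hS
  set U := thickening (r₁ + r₂) V with hU
  set τ := S * h with hτ
  have hτpos : 0 < τ := by positivity
  have hhτ : h ≤ τ := le_mul_of_one_le_left hh.le hS'
  set β := 2 ^ S * (8 * m * M.size) * (16 * m * M.size * h / R) ^ p with hβ
  have hβ0 : 0 ≤ β := by positivity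
  set q := 10 * m * τ / R with hq
  have hq0 : 0 ≤ q := by positivity
  have hτ16 : τ < R / (16 * m) := by
    refine hlt.trans_le ?_
    rw [← div_div]
    exact div_le_self (by positivity) M.one_le_size
  have hq1 : q ≤ 1 := by
    rw [lt_div_iff₀ (by positivity)] at hτ16
    rw [hq, div_le_one hR]
    nlinarith
  have hp1 : (0 : ℝ) < p + 1 := by positivity
  have hr₁ : 0 < r₁ := by
    have := hR.trans_le hR₁
    rw [lt_div_iff₀ hp1] at this
    linarith
  have hball : ∀ y ∈ thickening r₁ V, ball y R ⊆ U := by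
    intro y hy w hw
    rw [mem_thickening_iff] at hy
    obtain ⟨v, hv, hyv⟩ := hy
    rw [mem_ball] at hw
    refine mem_thickening_iff.2 ⟨v, hv, ?_⟩
    linarith [dist_triangle w y v]
  -- One comparison of flows; `δ` bounds the difference of the fields on a ball of radius `R`.
  have hpt : ∀ y ∈ thickening r₁ V, ∀ δ, (∀ w ∈ ball y R, ‖F w - G w‖ ≤ δ) →
      ‖F y - G y‖ ≤ Λ + β + q * δ := by
    intro y hy δ hδ
    have h1 := mul_norm_sub_le_norm_flow_sub hR hm (hball y hy)
      (hF.mono (hball y hy)).differentiableOn hFb (hG.mono (hball y hy)).differentiableOn hGb hδ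
      hτpos.le hτ16
    obtain ⟨-, -, h2⟩ := hM.iterate_step hS hR hm (hball y hy) (hG.mono (hball y hy)) hGb hh hlt
    have h3 := norm_sub_le_norm_sub_add_norm_sub (flow F U τ y) ((M.step G U h)^[S] y)
      (flow G U τ y)
    rw [norm_sub_rev (flow F U τ y) ((M.step G U h)^[S] y)] at h3
    have h4 : 2 ^ S * (R / 2 * (16 * m * M.size * h / R) ^ (p + 1)) = h * β := by
      rw [hβ, pow_succ]
      field_simp
      norm_num
    have h5 : h * β ≤ τ * β := by gcongr
    have h6 : 10 * m * δ * τ ^ 2 / R = τ * (q * δ) := by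
      rw [hq]
      ring
    have h7 : τ * ‖F y - G y‖ ≤ τ * (Λ + β + q * δ) := by
      linarith [hΛ y hy]
    exact le_of_mul_le_mul_left h7 hτpos
  have hΛ0 : 0 ≤ Λ := by
    have := (norm_nonneg _).trans (hΛ z (self_subset_thickening hr₁ V hz))
    exact nonneg_of_mul_nonneg_right this hτpos
  -- The start `k = 0` is the trivial bound `2 m`; each repetition gains a factor `q = O(h)`.
  have hmain : ∀ k ≤ p, ∀ y ∈ thickening (r₁ - k * (r₁ / (p + 1))) V,
      ‖F y - G y‖ ≤ k * (Λ + β) + 2 * m * q ^ k := by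
    intro k
    induction k with
    | zero =>
      intro _ y hy
      have hyU : y ∈ U := by
        refine hball y ?_ (mem_ball_self hR)
        simpa using hy
      have := norm_sub_le (F y) (G y)
      simp only [Nat.cast_zero, zero_mul, pow_zero]
      linarith [hFb y hyU, hGb y hyU]
    | succ k ih =>
      intro hk y hy
      have hη : 0 < r₁ / (p + 1) := by positivity
      have hy₁ : y ∈ thickening r₁ V := by
        refine thickening_mono ?_ V hy
        have : 0 ≤ ((k + 1 : ℕ) : ℝ) * (r₁ / (p + 1)) := by positivity
        linarith
      have h1 := hpt y hy₁ _ fun w hw => ih (by omega) w (by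
        rw [mem_thickening_iff] at hy
        obtain ⟨v, hv, hyv⟩ := hy
        rw [mem_ball] at hw
        refine mem_thickening_iff.2 ⟨v, hv, ?_⟩
        push_cast at hyv
        linarith [dist_triangle w y v])
      refine h1.trans ?_
      have h2 : q * (k * (Λ + β)) ≤ k * (Λ + β) :=
        mul_le_of_le_one_left (by positivity) hq1
      push_cast
      rw [pow_succ]
      linarith
  refine hmain p le_rfl z (self_subset_thickening ?_ V hz)
  have : r₁ - p * (r₁ / (p + 1)) = r₁ / (p + 1) := by
    field_simp
    ring
  rw [this]
  positivity

end

variable {D : ℕ}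

/-- The learning loss on `B(V, r₁)` is well defined for small steps: both fields move points by
less than `R ≤ r₂`, hence inside `B(V, r₁ + r₂)`. -/
theorem RungeKutta.HasOrder.lossWellDefined (hM : M.HasOrder p)
    {F G : (Fin D → ℂ) → (Fin D → ℂ)} {V : Set (Fin D → ℂ)} {r₁ r₂ R m h : ℝ} {S : ℕ}
    (hS : 1 ≤ S) (hR : 0 < R) (hm : 0 < m) (hR₂ : R ≤ r₂)
    (hF : AnalyticOnNhd ℂ F (thickening (r₁ + r₂) V))
    (hFb : ∀ y ∈ thickening (r₁ + r₂) V, ‖F y‖ ≤ m)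
    (hG : AnalyticOnNhd ℂ G (thickening (r₁ + r₂) V))
    (hGb : ∀ y ∈ thickening (r₁ + r₂) V, ‖G y‖ ≤ m)
    (hh : 0 < h) (hlt : S * h < R / (16 * m * M.size)) :
    LossWellDefined M S h F G (thickening (r₁ + r₂) V) (thickening r₁ V) := by
  have hκ := M.size_pos
  set U := thickening (r₁ + r₂) V with hU
  have hball : ∀ y ∈ thickening r₁ V, ball y R ⊆ U := by
    intro y hy w hw
    rw [mem_thickening_iff] at hy
    obtain ⟨v, hv, hyv⟩ := hy
    rw [mem_ball] at hw
    refine mem_thickening_iff.2 ⟨v, hv, ?_⟩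
    linarith [dist_triangle w y v]
  have hSh : 0 ≤ S * h := by positivity
  have hlt8 : S * h < R / (8 * m) := by
    refine hlt.trans_le ?_
    refine div_le_div_of_nonneg_left hR.le (by positivity) ?_
    linarith [mul_le_mul_of_nonneg_left M.one_le_size hm.le]
  have hflow : ∀ z ∈ thickening r₁ V, (∃ u, IsSolution F U z (S * h) u) ∧
      ‖flow F U (S * h) z - z‖ ≤ R / 8 := by
    intro z hz
    obtain ⟨u, -, -, hu⟩ := exists_holomorphic_flow hR hm (hball z hz)
      (hF.mono (hball z hz)).differentiableOn hFb
    obtain ⟨h1, h2⟩ := hu _ hSh hlt8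
    refine ⟨⟨_, h1⟩, ?_⟩
    rw [h2]
    refine (h1.norm_sub_le hFb ⟨hSh, le_rfl⟩).trans ?_
    rw [lt_div_iff₀ (by positivity)] at hlt8
    linarith
  refine ⟨fun z hz => (hflow z hz).1, fun z hz => ?_, ⟨R, ?_⟩⟩
  · exact (hM.iterate_step hS hR hm (hball z hz) (hG.mono (hball z hz)) hGb hh hlt).1
  · rintro _ ⟨z, hz, rfl⟩
    have h1 := (hM.iterate_step hS hR hm (hball z hz) (hG.mono (hball z hz)) hGb hh hlt).2.1
    have h2 := (hflow z hz).2
    have h3 := norm_sub_le_norm_sub_add_norm_sub ((M.step G U h)^[S] z) z (flow F U (S * h) z)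
    rw [norm_sub_rev z] at h3
    change ‖(M.step G U h)^[S] z - flow F U (S * h) z‖ ≤ R
    linarith

theorem learningLoss_nonneg {S : ℕ} {h : ℝ} (hh : 0 ≤ h) (F G : (Fin D → ℂ) → (Fin D → ℂ))
    (U K : Set (Fin D → ℂ)) : 0 ≤ learningLoss M S h F G U K := by
  refine div_nonneg (Real.sSup_nonneg ?_) (by positivity)
  rintro _ ⟨z, -, rfl⟩
  exact norm_nonneg _

theorem LossWellDefined.norm_defect_le {S : ℕ} {h : ℝ} (hS : 1 ≤ S) (hh : 0 < h)
    {F G : (Fin D → ℂ) → (Fin D → ℂ)} {U K : Set (Fin D → ℂ)}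
    (hL : LossWellDefined M S h F G U K) {z : Fin D → ℂ} (hz : z ∈ K) :
    ‖defect M S h F G U z‖ ≤ S * h * learningLoss M S h F G U K := by
  have hS' : (0 : ℝ) < S := by exact_mod_cast hS
  rw [learningLoss, mul_div_cancel₀ _ (by positivity)]
  exact le_csSup hL.finite ⟨z, hz, rfl⟩

end Complex

/-! ### Real trajectories -/

section Real

variable {E : Type*} [NormedAddCommGroup E] [NormedSpace ℝ E]

theorem IsSolution.continuousOn {g : E → E} {U : Set E} {z : E} {τ : ℝ} {u : ℝ → E}
    (hu : IsSolution g U z τ u) : ContinuousOn u (Icc 0 τ) :=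
  fun s hs => (hu.2 s hs).2.continuousWithinAt

/-- A smooth field satisfies a Lipschitz estimate between simultaneous points of any two curves
solving differential equations on a compact interval. -/
theorem exists_lipschitz_along_solutions {g g₁ g₂ : E → E} (hg : ContDiff ℝ (⊤ : ℕ∞) g)
    {U₁ U₂ : Set E} {z₁ z₂ : E} {τ : ℝ} {u₁ u₂ : ℝ → E} (h₁ : IsSolution g₁ U₁ z₁ τ u₁)
    (h₂ : IsSolution g₂ U₂ z₂ τ u₂) :
    ∃ K > (0 : ℝ), ∀ s ∈ Icc 0 τ, ‖g (u₁ s) - g (u₂ s)‖ ≤ K * ‖u₁ s - u₂ s‖ := by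
  have hc : IsCompact (u₁ '' Icc 0 τ ∪ u₂ '' Icc 0 τ) :=
    (isCompact_Icc.image_of_continuousOn h₁.continuousOn).union
      (isCompact_Icc.image_of_continuousOn h₂.continuousOn)
  have hll : LocallyLipschitz g := (hg.of_le (by exact_mod_cast le_top)).locallyLipschitz
  obtain ⟨K, hK⟩ := hll.locallyLipschitzOn.exists_lipschitzOnWith_of_compact hc
  refine ⟨K + 1, by positivity, fun s hs => ?_⟩
  have := hK.dist_le_mul (u₁ s) (Or.inl ⟨s, hs, rfl⟩) (u₂ s) (Or.inr ⟨s, hs, rfl⟩)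
  rw [dist_eq_norm, dist_eq_norm] at this
  linarith [norm_nonneg (u₁ s - u₂ s)]

theorem IsSolution.flow_eq {g : E → E} (hg : ContDiff ℝ (⊤ : ℕ∞) g) {U : Set E} {z : E} {τ s : ℝ}
    {u : ℝ → E} (hu : IsSolution g U z τ u) (hs : s ∈ Icc 0 τ) : flow g U s z = u s := by
  refine flow_eq_of_forall_eq (hu.mono hs.2) fun u' hu' => ?_
  obtain ⟨K, -, hK⟩ := exists_lipschitz_along_solutions hg hu' (hu.mono hs.2)
  have := hu'.norm_sub_le_gronwallBound (hu.mono hs.2) (ε := 0) hK (fun s _ => by simp)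
    ⟨hs.1, le_rfl⟩
  rw [sub_self, norm_zero, gronwallBound_ε0_δ0] at this
  exact sub_eq_zero.1 (norm_le_zero_iff.1 this)

theorem norm_complexify_sub {D : ℕ} (x y : Fin D → ℝ) :
    ‖complexify x - complexify y‖ = ‖x - y‖ := by
  have : ∀ i, ‖(complexify x - complexify y) i‖₊ = ‖(x - y) i‖₊ := by
    intro i
    simp only [complexify, Pi.sub_apply]
    rw [← Complex.ofReal_sub]
    exact Complex.nnnorm_real _
  simp only [Pi.norm_def, this]

theorem tube_eq_thickening {D : ℕ} (f : (Fin D → ℝ) → (Fin D → ℝ)) (x : Fin D → ℝ) (t r : ℝ) :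
    tube f x t r = thickening r (trajectory f x t) :=
  thickening_eq_biUnion_ball.symm

theorem trajectory_mono {D : ℕ} (f : (Fin D → ℝ) → (Fin D → ℝ)) (x : Fin D → ℝ) {s t : ℝ}
    (h : s ≤ t) : trajectory f x s ⊆ trajectory f x t :=
  image_mono (Icc_subset_Icc_right h)

theorem IsBoundedAnalyticExtension.mono {D : ℕ} {f : (Fin D → ℝ) → (Fin D → ℝ)}
    {F : (Fin D → ℂ) → (Fin D → ℂ)} {U U' : Set (Fin D → ℂ)} {m : ℝ}
    (hF : IsBoundedAnalyticExtension f F U m) (h : U' ⊆ U) :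
    IsBoundedAnalyticExtension f F U' m :=
  ⟨hF.analytic.mono h, fun x hx => hF.extends_real x (h hx), fun z hz => hF.bounded z (h hz)⟩

end Real

end NeuralODE

open NeuralODE
theorem corollary3p3 {I : ℕ} (M : RungeKutta I) (p : ℕ) (hp : 1 ≤ p) (hM : M.HasOrder p)
    (S : ℕ) (hS : 1 ≤ S) (ρ₁ ρ₂ : ℝ) (hρ₁ : 0 < ρ₁) (hρ₂ : 0 < ρ₂) :
    -- constants depending only on `r₁ / m`, `r₂ / m`, `S` and the method
    ∃ T₀ > (0 : ℝ), ∃ C₁ > (0 : ℝ),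
    ∀ r₁ r₂ m : ℝ, 0 < r₁ → 0 < r₂ → 0 < m → r₁ / m = ρ₁ → r₂ / m = ρ₂ →
    -- a constant that may depend on `m` as well
    ∃ C₂ > (0 : ℝ),
    ∀ (D : ℕ) (f fθ : (Fin D → ℝ) → (Fin D → ℝ)) (F Fθ : (Fin D → ℂ) → (Fin D → ℂ))
      (x : Fin D → ℝ) (t : ℝ), 0 ≤ t →
    ContDiff ℝ (⊤ : ℕ∞) f → ContDiff ℝ (⊤ : ℕ∞) fθ →
    (∃ y, IsSolution f Set.univ x t y) → (∃ y, IsSolution fθ Set.univ x t y) →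
    IsBoundedAnalyticExtension f F (tube f x t (r₁ + r₂)) m →
    IsBoundedAnalyticExtension fθ Fθ (tube f x t (r₁ + r₂)) m →
    (∀ h : ℝ, 0 < h → S * h < T₀ →
      LossWellDefined M S h F Fθ (tube f x t (r₁ + r₂)) (tube f x t r₁)) ∧
    -- the constants are uniform if the learned trajectory stays where the fields are controlled
    ((∀ τ ∈ Set.Icc 0 t, complexify (flow fθ Set.univ τ x) ∈ tube f x t (r₁ + r₂)) →
      ∀ h : ℝ, 0 < h → S * h < T₀ →
        ‖flow f Set.univ t x - flow fθ Set.univ t x‖ ≤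
          (C₂ * Real.exp (C₁ * t) - C₂) / C₁ *
            (h ^ p + learningLoss M S h F Fθ (tube f x t (r₁ + r₂)) (tube f x t r₁))) ∧
    -- in general `C₁` may also depend on the two fields, on `x` and on the time horizon `t`
    (∃ C₁' > (0 : ℝ), ∀ s ∈ Set.Icc 0 t, ∀ h : ℝ, 0 < h → S * h < T₀ →
        ‖flow f Set.univ s x - flow fθ Set.univ s x‖ ≤
          (C₂ * Real.exp (C₁' * s) - C₂) / C₁' *
            (h ^ p + learningLoss M S h F Fθ (tube f x s (r₁ + r₂)) (tube f x s r₁))) := by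
  have hκ := M.size_pos
  set σ := min (ρ₁ / (p + 1)) ρ₂ with hσ
  have hσpos : 0 < σ := lt_min (by positivity) hρ₂
  -- Balls of radius `m * σ` fit `p + 1` times into `r₁`, and into `r₂`; measured in units of
  -- `m`, all time scales depend on `σ` and the method only.
  refine ⟨σ / (16 * M.size), by positivity, 2 / (ρ₁ + ρ₂), by positivity, ?_⟩
  rintro r₁ r₂ m hr₁ hr₂ hm rfl rfl
  have hR : 0 < m * σ := by positivity
  have hR₁ : m * σ ≤ r₁ / (p + 1) := by
    calc m * σ ≤ m * (r₁ / m / (p + 1)) := by gcongr; exact min_le_left _ _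
      _ = r₁ / (p + 1) := by field_simp
  have hR₂ : m * σ ≤ r₂ := by
    calc m * σ ≤ m * (r₂ / m) := by gcongr; exact min_le_right _ _
      _ = r₂ := by field_simp
  have hT : m * σ / (16 * m * M.size) = σ / (16 * M.size) := by field_simp
  set B := 2 ^ S * (8 * m * M.size) * (16 * M.size / σ) ^ p with hB
  set c := 2 * m * (10 * S / σ) ^ p with hc
  have hp' : (1 : ℝ) ≤ p := by exact_mod_cast hp
  have hB0 : 0 ≤ B := by positivity
  have hc0 : 0 ≤ c := by positivity
  refine ⟨p + p * B + c, by positivity, ?_⟩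
  intro D f fθ F Fθ x t ht hf hfθ ⟨y, hy⟩ ⟨yθ, hyθ⟩ hF hFθ
  have hflow : ∀ s ∈ Set.Icc 0 t, flow f Set.univ s x = y s := fun s hs => hy.flow_eq hf hs
  have hflowθ : ∀ s ∈ Set.Icc 0 t, flow fθ Set.univ s x = yθ s := fun s hs => hyθ.flow_eq hfθ hs
  have hr : 0 < r₁ + r₂ := by positivity
  have hsubset : ∀ s ≤ t, tube f x s (r₁ + r₂) ⊆ tube f x t (r₁ + r₂) := fun s hs => by
    rw [tube_eq_thickening, tube_eq_thickening]
    exact Metric.thickening_subset_of_subset _ (trajectory_mono f x hs)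
  have hymem : ∀ τ ∈ Set.Icc 0 t, complexify (y τ) ∈ trajectory f x t := fun τ hτ =>
    ⟨τ, hτ, congrArg complexify (hflow τ hτ)⟩
  have hyball : ∀ τ ∈ Set.Icc 0 t,
      Metric.ball (complexify (y τ)) (r₁ + r₂) ⊆ tube f x t (r₁ + r₂) := fun τ hτ => by
    rw [tube_eq_thickening]
    exact Metric.ball_subset_thickening (hymem τ hτ) _
  have hyU : ∀ τ ∈ Set.Icc 0 t, complexify (y τ) ∈ tube f x t (r₁ + r₂) := fun τ hτ =>
    hyball τ hτ (Metric.mem_ball_self hr)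
  have hloss : ∀ s ∈ Set.Icc 0 t, ∀ h : ℝ, 0 < h → S * h < σ / (16 * M.size) →
      LossWellDefined M S h F Fθ (tube f x s (r₁ + r₂)) (tube f x s r₁) := by
    intro s hs h hh hlt
    have h1 := hF.mono (hsubset s hs.2)
    have h2 := hFθ.mono (hsubset s hs.2)
    rw [tube_eq_thickening] at h1 h2
    rw [tube_eq_thickening, tube_eq_thickening]
    exact hM.lossWellDefined hS hR hm hR₂ h1.analytic h1.bounded h2.analytic h2.bounded hh
      (by rwa [hT])
  have hfield : ∀ s ∈ Set.Icc 0 t, ∀ h : ℝ, 0 < h → S * h < σ / (16 * M.size) →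
      ∀ τ ∈ Set.Icc 0 s, ‖fθ (y τ) - f (y τ)‖ ≤ (p + p * B + c) *
        (h ^ p + learningLoss M S h F Fθ (tube f x s (r₁ + r₂)) (tube f x s r₁)) := by
    intro s hs h hh hlt τ hτ
    have hτt : τ ∈ Set.Icc 0 t := ⟨hτ.1, hτ.2.trans hs.2⟩
    set Λ := learningLoss M S h F Fθ (tube f x s (r₁ + r₂)) (tube f x s r₁) with hΛ
    have hΛ0 : 0 ≤ Λ := learningLoss_nonneg hh.le _ _ _ _
    have hdef : ∀ z ∈ tube f x s r₁, ‖(M.step Fθ (tube f x s (r₁ + r₂)) h)^[S] z -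
        flow F (tube f x s (r₁ + r₂)) (S * h) z‖ ≤ S * h * Λ := fun z hz =>
      (hloss s hs h hh hlt).norm_defect_le hS hh hz
    have h1 := hF.mono (hsubset s hs.2)
    have h2 := hFθ.mono (hsubset s hs.2)
    rw [tube_eq_thickening] at h1 h2
    simp only [tube_eq_thickening] at hdef
    have hyV : complexify (y τ) ∈ trajectory f x s := ⟨τ, hτ, congrArg complexify (hflow τ hτt)⟩
    have hmain := hM.norm_vectorField_sub_le hS hR hm hR₁ hR₂ h1.analytic h1.bounded h2.analytic
      h2.bounded hh (by rwa [hT]) hdef hyV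
    rw [hF.extends_real _ (hyU τ hτt), hFθ.extends_real _ (hyU τ hτt), norm_complexify_sub] at hmain
    rw [norm_sub_rev]
    have e1 : 2 ^ S * (8 * m * M.size) * (16 * m * M.size * h / (m * σ)) ^ p = B * h ^ p := by
      rw [hB, mul_assoc, mul_assoc _ _ (h ^ p), ← mul_pow, ← mul_assoc]
      congr 2
      field_simp
    have e2 : 2 * m * (10 * m * (S * h) / (m * σ)) ^ p = c * h ^ p := by
      rw [hc, mul_assoc _ _ (h ^ p), ← mul_pow]
      congr 2
      field_simp
    rw [e1, e2] at hmain
    refine hmain.trans ?_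
    have h3 : 0 ≤ h ^ p := by positivity
    have h4 : 0 ≤ p * h ^ p := by positivity
    have h5 : 0 ≤ (p * B + c) * Λ := by positivity
    linarith
  have hgronwall : ∀ C₁ > (0 : ℝ), ∀ s ∈ Set.Icc 0 t,
      (∀ τ ∈ Set.Icc 0 s, ‖fθ (yθ τ) - fθ (y τ)‖ ≤ C₁ * ‖yθ τ - y τ‖) →
      ∀ h : ℝ, 0 < h → S * h < σ / (16 * M.size) →
        ‖flow f Set.univ s x - flow fθ Set.univ s x‖ ≤
          ((p + p * B + c) * Real.exp (C₁ * s) - (p + p * B + c)) / C₁ *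
            (h ^ p + learningLoss M S h F Fθ (tube f x s (r₁ + r₂)) (tube f x s r₁)) := by
    intro C₁ hC₁ s hs hlip h hh hlt
    have := (hyθ.mono hs.2).norm_sub_le_gronwallBound (hy.mono hs.2) hlip (hfield s hs h hh hlt)
      ⟨hs.1, le_rfl⟩
    rw [sub_self, norm_zero, gronwallBound_of_K_ne_0 hC₁.ne'] at this
    rw [hflow s hs, hflowθ s hs, norm_sub_rev]
    refine this.trans (le_of_eq ?_)
    ring
  have htmem : t ∈ Set.Icc 0 t := ⟨ht, le_rfl⟩
  refine ⟨hloss t htmem, fun hin => ?_, ?_⟩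
  -- The learned trajectory stays in the tube, where `Fθ` is bounded by `m`: the Lipschitz
  -- constant relative to the points of the exact trajectory is `2 m / (r₁ + r₂)`.
  · refine hgronwall _ (by positivity) t htmem fun τ hτ => ?_
    have hyθU : complexify (yθ τ) ∈ tube f x t (r₁ + r₂) := by
      rw [← hflowθ τ hτ]
      exact hin τ hτ
    have := norm_sub_le_of_differentiableOn_ball hr
      (hFθ.analytic.mono (hyball τ hτ)).differentiableOn
      (fun w hw => hFθ.bounded w (hyball τ hτ hw)) (hFθ.bounded _ hyθU)
    rw [hFθ.extends_real _ (hyU τ hτ), hFθ.extends_real _ hyθU, norm_complexify_sub,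
      norm_complexify_sub, norm_sub_rev, norm_sub_rev (y τ)] at this
    convert this using 2
    field_simp
  -- Otherwise take a Lipschitz constant of `fθ` on the compact union of the two trajectories.
  · obtain ⟨K, hK, hlip⟩ := exists_lipschitz_along_solutions hfθ hyθ hy
    exact ⟨K, hK, fun s hs => hgronwall K hK s hs fun τ hτ => hlip τ ⟨hτ.1, hτ.2.trans hs.2⟩⟩
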